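/- Let $\mathbf k$ be a field of characteristic $0$ and let $\mathcal L=\mathcal L_{\ge0}\supset\mathcal L_{\ge1}\supset\mathcal L_{\ge2}\supset\cdots$ be a complete filtered Lie algebra over $\mathbf k$: the $\mathcal L_{\ge m}$ are linear subspaces with $[\mathcal L_{\ge m},\mathcal L_{\ge n}]\subset\mathcal L_{\ge m+n}$ for all $m,n\ge 0$ and $\bigcap_m\mathcal L_{\ge m}=\{0\}$, and $\mathcal L$ is a complete metric space for $d(X,Y)=2^{-\operatorname{ord}(Y-X)}$, where $\operatorname{ord}(X)\ge m\iff X\in\mathcal L_{\ge m}$. Let $X_0\in\mathcal L$, let $\mathcal N$ be a set, $\varphi\colon\mathcal N\to\mathbf k$ a function, and let $B=\sum_{n\in\mathcal N}B_n$ be a formally convergent series in $\mathcal L$ (unconditional convergence for $d$) with $$B_n\in\mathcal L_{\ge1},\qquad [X_0,B_n]=\varphi(n)B_n\qquad\text{for every } n\in\mathcal N .$$ For a word $\underline n=n_1\cdots n_r$ on the alphabet $\mathcal N$ put $r(\underline n)=r$, $\varphi(\underline n)=\varphi(n_1)+\cdots+\varphi(n_r)$, and $$T^{\underline n}(\varepsilon)=\prod_{j=1}^{r}\frac{1}{\varphi(n_1\cdots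 n_j)+j\varepsilon}\in\mathbf k((\varepsilon)).$$ Let $\pi_+,\pi_-$ be the projectors of $\mathbf k((\varepsilon))=\mathbf k[[\varepsilon]]\oplus\varepsilon^{-1}\mathbf k[\varepsilon^{-1}]$ onto the first and the second summand. Define $U_-^{\underline n}$ and $U_+^{\underline n}$ by induction on $r(\underline n)$: both are $1$ on the empty word, and for nonempty $\underline n$ $$U_-^{\underline n}=-\pi_-(D^{\underline n}),\qquad U_+^{\underline n}=\pi_+(D^{\underline n}),\qquad D^{\underline n}=\sum_{\underline n=\underline a\,\underline b,\ \underline b\neq\emptyset}U_-^{\underline a}\,T^{\underline b}.$$ Let $R^{\underline n}\in\mathbf k$ be $-r(\underline n)$ times the residue (coefficient of $\varepsilon^{-1}$) of $U_-^{\underline n}$, and let $S^{\underline n}\in\mathbf k$ be the constant term (coefficient of $\varepsilon^{0}$) of $U_+^{\underline n}$. Then the series $$N=\sum_{r\ge1}\ \sum_{n_1,\dots,n_r\in\mathcal N}\frac1r\,R^{n_1\cdots n_r}\,[B_{n_1},[\ldots[B_{n_{r-1}},B_{n_r}]\ldots]],\qquad \Psi=\sum_{r\ge0}\ \sum_{n_1,\dots,n_r\in\mathcal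 N}S^{n_1\cdots n_r}\,\operatorname{ad}_{B_{n_1}}\cdots\operatorname{ad}_{B_{n_r}}$$ converge formally, the first one in $\mathcal L$ and the second one in the space of linear operators of $\mathcal L$ (filtered by: $A$ has order $\ge m$ if $A(\mathcal L_{\ge p})\subset\mathcal L_{\ge p+m}$ for all $p$); the operator $\Psi$ is a Lie algebra automorphism of $\mathcal L$, and $$\Psi(X_0+B)=X_0+N,\qquad [X_0,N]=0 .$$ -/

import Mathlib

/-- `F` is a filtration `L = F 0 ⊇ F 1 ⊇ F 2 ⊇ ⋯` by linear subspaces which makes `L` a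
complete filtered Lie algebra.  In terms of the order function `ord X ≥ m ↔ X ∈ F m` and of the
distance `d(X, Y) = 2 ^ (-ord (Y - X))`, the field `separated` says that `d` is a distance, and
`complete` says that every sequence that is Cauchy for `d` converges for `d`. -/
structure IsCompleteLieFiltration {k L : Type*} [Field k] [LieRing L] [LieAlgebra k L]
    (F : ℕ → Submodule k L) : Prop where
  zero_eq_top : F 0 = ⊤
  antitone : Antitone F
  lie_mem : ∀ (m n : ℕ) (X Y : L), X ∈ F m → Y ∈ F n → ⁅X, Y⁆ ∈ F (m + n)
  separated : ⨅ m, F m = ⊥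
  complete : ∀ X : ℕ → L,
    (∀ m, ∃ i₀, ∀ i j, i₀ ≤ i → i₀ ≤ j → X i - X j ∈ F m) →
      ∃ Y : L, ∀ m, ∃ i₀, ∀ i, i₀ ≤ i → X i - Y ∈ F m

/-- Convergence of a family to the sum `s`, for the topology defined by the filtration `F`: the
finite partial sums converge to `s` along the directed set of finite subsets of the index set.
In particular, for every `m`, all but finitely many terms lie in `F m`. -/
def HasFormalSum {k M ι : Type*} [Field k] [AddCommGroup M] [Module k M]
    (F : ℕ → Submodule k M) (f : ι → M) (s : M) : Prop :=
  ∀ m, ∃ A₀ : Finset ι, ∀ A : Finset ι, A₀ ⊆ A → s - ∑ i ∈ A, f i ∈ F m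

/-- The filtration induced by `F` on the linear operators of `M`: an operator has order `≥ m` if
it raises the order of every element by at least `m`.  When `F 0 = ⊤`, convergence of a series of
operators for this filtration implies its convergence at every element, uniformly. -/
def endFiltration {k M : Type*} [Field k] [AddCommGroup M] [Module k M]
    (F : ℕ → Submodule k M) (m : ℕ) : Submodule k (Module.End k M) where
  carrier := {A | ∀ (p : ℕ) (X : M), X ∈ F p → A X ∈ F (p + m)}
  add_mem' hA hB p X hX := (F (p + m)).add_mem (hA p X hX) (hB p X hX)
  zero_mem' p _ _ := (F (p + m)).zero_mem
  smul_mem' c _ hA p X hX := (F (p + m)).smul_mem c (hA p X hX)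

/-- The iterated bracket `[B_{n₁}, [B_{n₂}, … [B_{n_{r-1}}, B_{n_r}] … ]]` of a word `n₁ ⋯ n_r`
(equal to `B_{n₁}` if `r = 1`, and to `0` for the empty word by convention). -/
def nestedBracket {L 𝒩 : Type*} [LieRing L] (B : 𝒩 → L) : List 𝒩 → L
  | [] => 0
  | [n] => B n
  | n :: n' :: w => ⁅B n, nestedBracket B (n' :: w)⁆

/-- The composite operator `ad_{B_{n₁}} ∘ ⋯ ∘ ad_{B_{n_r}}` of a word `n₁ ⋯ n_r`
(the identity for the empty word). -/
noncomputable def adWord (k : Type*) {L 𝒩 : Type*} [Field k] [LieRing L] [LieAlgebra k L]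
    (B : 𝒩 → L) (w : List 𝒩) : Module.End k L :=
  (w.map fun n => LieAlgebra.ad k L (B n)).prod

/-- The projector `π₋` of `k((ε)) = k[[ε]] ⊕ ε⁻¹ k[ε⁻¹]` onto the polar part `ε⁻¹ k[ε⁻¹]`. -/
noncomputable def piMinus {k : Type*} [Field k] (f : LaurentSeries k) : LaurentSeries k :=
  HahnSeries.truncLT (0 : ℤ) f

/-- The projector `π₊` of `k((ε)) = k[[ε]] ⊕ ε⁻¹ k[ε⁻¹]` onto the regular part `k[[ε]]`. -/
noncomputable def piPlus {k : Type*} [Field k] (f : LaurentSeries k) : LaurentSeries k :=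
  f - piMinus f

/-- The mould `T`, with values in `k((ε))`:
`T^{n₁ ⋯ n_r} = ∏_{j=1}^{r} 1 / (φ(n₁) + ⋯ + φ(n_j) + j ε)`. -/
noncomputable def mouldT {k 𝒩 : Type*} [Field k] (φ : 𝒩 → k) (w : List 𝒩) : LaurentSeries k :=
  ∏ j ∈ Finset.Icc 1 w.length,
    (HahnSeries.C ((w.take j).map φ).sum + (j : LaurentSeries k) * HahnSeries.single (1 : ℤ) 1)⁻¹

/-- The mould `U₋`, by recursion on the length of words: `U₋` is `1` on the empty word, and
`U₋^w = -π₋ (∑ U₋^a T^b)` for `w` nonempty, the sum being over the decompositions `w = a b`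
into two words with `b` nonempty, i.e. `a = w.take i`, `b = w.drop i` with `i < w.length`. -/
noncomputable def mouldUMinus {k 𝒩 : Type*} [Field k] (φ : 𝒩 → k) : List 𝒩 → LaurentSeries k
  | [] => 1
  | n :: w => -piMinus (∑ i : Fin (n :: w).length,
      mouldUMinus φ ((n :: w).take i) * mouldT φ ((n :: w).drop i))
termination_by w => w.length
decreasing_by
  rw [List.length_take]
  exact lt_of_le_of_lt (min_le_left _ _) i.isLt

/-- `D^w = ∑ U₋^a T^b`, sum over the decompositions `w = a b` with `b` nonempty. -/
noncomputable def mouldD {k 𝒩 : Type*} [Field k] (φ : 𝒩 → k) (w : List 𝒩) : LaurentSeries k :=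
  ∑ i : Fin w.length, mouldUMinus φ (w.take i) * mouldT φ (w.drop i)

theorem mouldUMinus_nil {k 𝒩 : Type*} [Field k] (φ : 𝒩 → k) :
    mouldUMinus φ ([] : List 𝒩) = 1 := by
  rw [mouldUMinus]

theorem mouldUMinus_of_ne_nil {k 𝒩 : Type*} [Field k] (φ : 𝒩 → k) {w : List 𝒩} (hw : w ≠ []) :
    mouldUMinus φ w = -piMinus (mouldD φ w) := by
  cases w with
  | nil => exact absurd rfl hw
  | cons n w => rw [mouldUMinus, mouldD]

/-- The mould `U₊`: it is `1` on the empty word, and `U₊^w = π₊(D^w)` for `w` nonempty. -/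
noncomputable def mouldUPlus {k 𝒩 : Type*} [Field k] (φ : 𝒩 → k) : List 𝒩 → LaurentSeries k
  | [] => 1
  | n :: w => piPlus (mouldD φ (n :: w))

/-- `R^w = -r(w) · (residue of U₋^w)`, where `r(w)` is the length of `w`. -/
noncomputable def mouldR {k 𝒩 : Type*} [Field k] (φ : 𝒩 → k) (w : List 𝒩) : k :=
  -(w.length : k) * (mouldUMinus φ w).coeff (-1)

/-- `S^w = constant term of U₊^w`. -/
noncomputable def mouldS {k 𝒩 : Type*} [Field k] (φ : 𝒩 → k) (w : List 𝒩) : k :=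
  (mouldUPlus φ w).coeff 0

/-! Work with moulds, i.e. functions on words, under the product dual to concatenation.
Multiplication by ω(w) = φ(w) + r(w)ε is a derivation of this product, and T satisfies ω(wn) T(wn) =
T(w). The recursion defining U₋ and U₊ is a Birkhoff factorisation U₊ = U₋ × T
(`mouldUPlus_eq_mouldMul`). T is symmetral; since a polar series that is also regular is zero, U₋
and U₊ are symmetral too. Taking the constant term of U₊ and the residue of U₋ makes S symmetral and
R alternal.

The same polar/regular argument gives ω U₋ = -R × U₋ (`mouldOmega_mul_mouldUMinus`). The derivation
rule then gives an equation for U₊, whose constant term is (R × S)(wn) = S(w) - φ(wn) S(wn)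
(`mouldMul_mouldR_mouldS`). The equation for U₋ also forces U₋(w) = 0 when φ(w) ≠ 0, so φR = 0,
whence [X₀, N] = 0.

On the Lie side, the Leibniz rule for ad-words is expressed by shuffles, so symmetrality of S makes
Ψ respect brackets; Ψ is bijective because Ψ - 1 raises the order. Since ad_{wn} X₀ = -φ(n) ad_w Bₙ,
the difference Ψ(X₀ + B) - X₀ is a series of nested brackets with coefficients M(wn) = S(w) - φ(n)
S(wn). It remains to compare M with R/r. Nested brackets satisfy linear relations, so the moulds
need not agree. It suffices that they agree after applying `dynkinDual`, the transpose of commutator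
expansion, by the dual Dynkin–Specht–Wever identity `sum_dynkinDual_smul_nestedBracket`. Both images
equal R: for M by the equation for R × S, for R/r by alternality. -/

section Moulds

/-! ### Shuffles and the mould product. -/

variable {α K : Type*}

/-- The sum of the values of `M` over all the shuffles of two words, with multiplicity. -/
def shuffleSum [Add K] : (List α → K) → List α → List α → K
  | M, [], v => M v
  | M, a :: u, [] => M (a :: u)
  | M, a :: u, b :: v =>
      shuffleSum (fun w => M (a :: w)) u (b :: v) + shuffleSum (fun w => M (b :: w)) (a :: u) v
termination_by _ u v => u.length + v.length

@[simp]
theorem shuffleSum_nil_left [Add K] (M : List α → K) (v : List α) : shuffleSum M [] v = M v := by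
  rw [shuffleSum]

@[simp]
theorem shuffleSum_nil_right [Add K] (M : List α → K) (u : List α) : shuffleSum M u [] = M u := by
  cases u <;> rw [shuffleSum]

theorem shuffleSum_cons_cons [Add K] (M : List α → K) (a b : α) (u v : List α) :
    shuffleSum M (a :: u) (b :: v) =
      shuffleSum (fun w => M (a :: w)) u (b :: v) +
        shuffleSum (fun w => M (b :: w)) (a :: u) v := by
  rw [shuffleSum]

/-- Only the values on the permutations of `u ++ v` contribute to `shuffleSum M u v`. -/
theorem shuffleSum_congr [Add K] {M M' : List α → K} {u v : List α}
    (h : ∀ w, w.Perm (u ++ v) → M w = M' w) : shuffleSum M u v = shuffleSum M' u v := by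
  induction u generalizing M M' v with
  | nil => simpa using h v (by simp)
  | cons a u ihu =>
    induction v generalizing M M' with
    | nil => simpa using h (a :: u) (by simp)
    | cons b v ihv =>
      rw [shuffleSum_cons_cons, shuffleSum_cons_cons]
      congr 1
      · exact ihu fun w hw => h _ (hw.cons a)
      · exact ihv fun w hw => h _ ((hw.cons b).trans List.perm_middle.symm)

theorem shuffleSum_map {K' : Type*} [AddZeroClass K] [AddZeroClass K'] (f : K →+ K')
    (M : List α → K) (u v : List α) :
    shuffleSum (fun w => f (M w)) u v = f (shuffleSum M u v) := by
  induction u generalizing M v with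
  | nil => simp
  | cons a u ihu =>
    induction v generalizing M with
    | nil => simp
    | cons b v ihv =>
      rw [shuffleSum_cons_cons, shuffleSum_cons_cons, map_add,
        ihu (fun w => M (a :: w)), ihv (fun w => M (b :: w))]

theorem shuffleSum_add [AddCommSemigroup K] (M M' : List α → K) (u v : List α) :
    shuffleSum (fun w => M w + M' w) u v = shuffleSum M u v + shuffleSum M' u v := by
  induction u generalizing M M' v with
  | nil => simp
  | cons a u ihu =>
    induction v generalizing M M' with
    | nil => simp
    | cons b v ihv =>
      rw [shuffleSum_cons_cons, shuffleSum_cons_cons, shuffleSum_cons_cons,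
        ihu (fun w => M (a :: w)), ihv (fun w => M (b :: w)), add_add_add_comm]

theorem shuffleSum_const_mul [NonUnitalNonAssocSemiring K] (c : K) (M : List α → K)
    (u v : List α) : shuffleSum (fun w => c * M w) u v = c * shuffleSum M u v :=
  shuffleSum_map (AddMonoidHom.mulLeft c) M u v

theorem shuffleSum_mem [AddGroup K] (H : AddSubgroup K) {M : List α → K} {u v : List α}
    (h : ∀ w, w.Perm (u ++ v) → M w ∈ H) : shuffleSum M u v ∈ H := by
  induction u generalizing M v with
  | nil => simpa using h v (by simp)
  | cons a u ihu =>
    induction v generalizing M with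
    | nil => simpa using h (a :: u) (by simp)
    | cons b v ihv =>
      rw [shuffleSum_cons_cons]
      refine H.add_mem ?_ ?_
      · exact ihu fun w hw => h _ (hw.cons a)
      · exact ihv fun w hw => h _ ((hw.cons b).trans List.perm_middle.symm)

/-- The recursion of `shuffleSum` splits by first letter; this is its mirror image. It is needed
because T, `dynkinDual` and the conjugacy equation are all governed by last letters. -/
theorem shuffleSum_concat_concat [AddCommSemigroup K] (M : List α → K) (a b : α)
    (u v : List α) :
    shuffleSum M (u ++ [a]) (v ++ [b]) =
      shuffleSum (fun w => M (w ++ [a])) u (v ++ [b]) +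
        shuffleSum (fun w => M (w ++ [b])) (u ++ [a]) v := by
  induction u generalizing M v with
  | nil =>
    induction v generalizing M with
    | nil => simp [shuffleSum_cons_cons, add_comm]
    | cons d v ihv =>
      have := ihv (fun w => M (d :: w))
      simp only [List.nil_append, shuffleSum_nil_left] at this
      simp only [List.nil_append, List.cons_append, shuffleSum_cons_cons, shuffleSum_nil_left,
        this]
      ac_rfl
  | cons c u ihu =>
    induction v generalizing M with
    | nil =>
      have := ihu (fun w => M (c :: w)) []
      simp only [List.nil_append, shuffleSum_nil_right] at this
      simp only [List.nil_append, List.cons_append, shuffleSum_cons_cons, shuffleSum_nil_right,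
        this]
      ac_rfl
    | cons d v ihv =>
      have h1 := ihu (fun w => M (c :: w)) (d :: v)
      have h2 := ihv (fun w => M (d :: w))
      simp only [List.cons_append] at h1 h2
      simp only [List.cons_append, shuffleSum_cons_cons] at h1 h2 ⊢
      rw [h1, h2]
      ac_rfl

/-- The product of moulds. -/
def mouldMul [Add K] [Mul K] : (List α → K) → (List α → K) → List α → K
  | M, N, [] => M [] * N []
  | M, N, n :: w => M [] * N (n :: w) + mouldMul (fun u => M (n :: u)) N w

@[simp]
theorem mouldMul_nil [Add K] [Mul K] (M N : List α → K) : mouldMul M N [] = M [] * N [] := rfl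

theorem mouldMul_cons [Add K] [Mul K] (M N : List α → K) (n : α) (w : List α) :
    mouldMul M N (n :: w) = M [] * N (n :: w) + mouldMul (fun u => M (n :: u)) N w := rfl

section Ring

variable [CommRing K]

theorem mouldMul_eq_sum (M N : List α → K) (w : List α) :
    mouldMul M N w = ∑ i ∈ Finset.range (w.length + 1), M (w.take i) * N (w.drop i) := by
  induction w generalizing M with
  | nil => simp
  | cons n w ih =>
    rw [List.length_cons, Finset.sum_range_succ', mouldMul_cons, ih]
    simp [add_comm]

theorem mouldMul_concat (M N : List α → K) (n : α) (w : List α) :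
    mouldMul M N (w ++ [n]) = mouldMul M (fun u => N (u ++ [n])) w + M (w ++ [n]) * N [] := by
  induction w generalizing M with
  | nil => simp [mouldMul_cons]
  | cons a w ih => simp [mouldMul_cons, ih, add_assoc]

theorem mouldMul_add_left (M M' N : List α → K) (w : List α) :
    mouldMul (fun u => M u + M' u) N w = mouldMul M N w + mouldMul M' N w := by
  simp only [mouldMul_eq_sum, add_mul, Finset.sum_add_distrib]

theorem mouldMul_const_mul_left (c : K) (M N : List α → K) (w : List α) :
    mouldMul (fun u => c * M u) N w = c * mouldMul M N w := by
  simp only [mouldMul_eq_sum, mul_assoc, Finset.mul_sum]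

theorem mouldMul_assoc (M N P : List α → K) (w : List α) :
    mouldMul (mouldMul M N) P w = mouldMul M (mouldMul N P) w := by
  induction w generalizing M with
  | nil => simp [mul_assoc]
  | cons n w ih =>
    rw [mouldMul_cons, mouldMul_cons, ← ih, mouldMul_cons N P]
    simp only [mouldMul_cons, mouldMul_nil]
    rw [mouldMul_add_left, mouldMul_const_mul_left]
    ring

/-- Multiplication by an additive function of the word is a derivation of the mould product. -/
theorem mul_mouldMul {ω : List α → K} (hω : ∀ u v, ω (u ++ v) = ω u + ω v) (M N : List α → K)
    (w : List α) :
    ω w * mouldMul M N w =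
      mouldMul (fun u => ω u * M u) N w + mouldMul M (fun u => ω u * N u) w := by
  simp only [mouldMul_eq_sum, Finset.mul_sum, ← Finset.sum_add_distrib]
  refine Finset.sum_congr rfl fun i _ => ?_
  have : ω w = ω (w.take i) + ω (w.drop i) := by rw [← hω, List.take_append_drop]
  rw [this]
  ring

/-- Every other term of the product has a strictly shorter prefix. In inductions on length this lets
a right factor be inserted or removed freely. -/
theorem mouldMul_eq_of_forall_lt {M N : List α → K} (hN : N [] = 1) {w : List α}
    (h : ∀ u, u.length < w.length → M u = 0) : mouldMul M N w = M w := by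
  rw [mouldMul_eq_sum, Finset.sum_range_succ, Finset.sum_eq_zero, zero_add]
  · simp [hN]
  · intro i hi
    rw [h, zero_mul]
    simpa using hi

theorem mouldMul_eq_left {M N : List α → K} (h0 : N [] = 1) (hN : ∀ u, u ≠ [] → N u = 0)
    (w : List α) : mouldMul M N w = M w := by
  rw [mouldMul_eq_sum, Finset.sum_range_succ, Finset.sum_eq_zero, zero_add]
  · simp [h0]
  · intro i hi
    rw [hN, mul_zero]
    simpa using hi

theorem mouldMul_mem (H : Subring K) {M N : List α → K} (hM : ∀ u, M u ∈ H) (hN : ∀ u, N u ∈ H)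
    (w : List α) : mouldMul M N w ∈ H := by
  rw [mouldMul_eq_sum]
  exact H.sum_mem fun i _ => H.mul_mem (hM _) (hN _)

/-- Cutting a shuffle of `u` and `v` in two cuts each of `u` and `v` and shuffles the pieces:
deconcatenation is multiplicative for the shuffle product. -/
theorem shuffleSum_mouldMul (M N : List α → K) (u v : List α) :
    shuffleSum (mouldMul M N) u v =
      ∑ i ∈ Finset.range (u.length + 1), ∑ j ∈ Finset.range (v.length + 1),
        shuffleSum M (u.take i) (v.take j) * shuffleSum N (u.drop i) (v.drop j) := by
  induction u generalizing M v with
  | nil => simp [mouldMul_eq_sum]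
  | cons a u ihu =>
    induction v generalizing M with
    | nil => simp [mouldMul_eq_sum]
    | cons b v ihv =>
      rw [shuffleSum_cons_cons]
      simp only [mouldMul_cons, shuffleSum_add, shuffleSum_const_mul]
      rw [ihu (fun w => M (a :: w)), ihv (fun w => M (b :: w))]
      simp only [List.length_cons, Finset.sum_range_succ', List.take_succ_cons,
        List.drop_succ_cons, List.take_zero, List.drop_zero, shuffleSum_nil_left,
        shuffleSum_nil_right, shuffleSum_cons_cons, add_mul, Finset.sum_add_distrib]
      ring

/-! ### Symmetral and alternal moulds, and the transpose of commutator expansion. -/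

/-- Symmetral moulds: multiplicative with respect to shuffles. -/
structure IsSymmetral (M : List α → K) : Prop where
  map_nil : M [] = 1
  shuffle : ∀ u v, shuffleSum M u v = M u * M v

/-- Alternal moulds: vanishing on nontrivial shuffles. -/
structure IsAlternal (M : List α → K) : Prop where
  map_nil : M [] = 0
  shuffle : ∀ u v, u ≠ [] → v ≠ [] → shuffleSum M u v = 0

/-- If `N` is symmetral, and `M` satisfies the symmetrality relations for all pairs of prefixes
of `u` and `v` other than `(u, v)`, then the defects of symmetrality of `M × N` and `M`
at `(u, v)` agree. -/
theorem shuffleSum_mouldMul_sub {M N : List α → K} (hN : IsSymmetral N) (u v : List α)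
    (h : ∀ a b, a.length + b.length < u.length + v.length →
      shuffleSum M a b = M a * M b) :
    shuffleSum (mouldMul M N) u v - mouldMul M N u * mouldMul M N v =
      shuffleSum M u v - M u * M v := by
  rw [shuffleSum_mouldMul, mouldMul_eq_sum M N u, mouldMul_eq_sum M N v, Finset.sum_mul_sum,
    ← Finset.sum_sub_distrib]
  simp only [← Finset.sum_sub_distrib]
  rw [Finset.sum_eq_single u.length, Finset.sum_eq_single v.length]
  · simp [hN.map_nil]
  · intro j hj hj'
    rw [Finset.mem_range] at hj
    rw [h, hN.shuffle]
    · ring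
    · simp only [List.length_take]; omega
  · simp
  · intro i hi hi'
    rw [Finset.mem_range] at hi
    refine Finset.sum_eq_zero fun j hj => ?_
    rw [Finset.mem_range] at hj
    rw [h, hN.shuffle]
    · ring
    · simp only [List.length_take]; omega
  · simp

/-- The adjoint of the operator replacing words by iterated commutators: the sum of
`(-1) ^ |b| M ((a₀ a ⧢ b̃) n)` over the factorisations `w = a n b`, with `b̃` the reversal
of `b` and `a₀` a prefix which serves as an accumulator. -/
def dynkinDual (M : List α → K) : List α → List α → K
  | _, [] => 0
  | a, n :: b =>
      (-1) ^ b.length * shuffleSum (fun w => M (w ++ [n])) a b.reverse + dynkinDual M (a ++ [n]) b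

/-- The shuffled words come from `x :: a` and from a reversal beginning with `y`, so each starts
with `x` or `y`; removing `y` shortens the right part and flips the sign. -/
theorem dynkinDual_cons_concat (M : List α → K) (x y : α) (a b : List α) :
    dynkinDual M (x :: a) (b ++ [y]) =
      dynkinDual (fun w => M (x :: w)) a (b ++ [y]) -
        dynkinDual (fun w => M (y :: w)) (x :: a) b := by
  induction b generalizing a with
  | nil => simp [dynkinDual]
  | cons n b ih =>
    have := ih (a ++ [n])
    simp only [List.cons_append, dynkinDual, this, List.length_append, List.length_cons,
      List.length_nil, List.reverse_append, List.reverse_cons, List.reverse_nil, List.nil_append,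
      shuffleSum_cons_cons]
    ring

/-- Transpose of [b, P] = bP - Pb: the outermost letter of a nested commutator ends up either first
or last in the expanded word. All inductions on nested brackets below use `dynkinDual` through this
recursion. -/
theorem dynkinDual_nil_cons_concat (M : List α → K) (x y : α) (u : List α) :
    dynkinDual M [] (x :: (u ++ [y])) =
      dynkinDual (fun w => M (x :: w)) [] (u ++ [y]) -
        dynkinDual (fun w => M (y :: w)) [] (x :: u) := by
  rw [dynkinDual, List.nil_append, dynkinDual_cons_concat]
  simp only [dynkinDual, List.length_append, List.reverse_append, shuffleSum_nil_left]
  simp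
  ring

theorem dynkinDual_add (M M' : List α → K) (a b : List α) :
    dynkinDual (fun w => M w + M' w) a b = dynkinDual M a b + dynkinDual M' a b := by
  induction b generalizing a with
  | nil => simp [dynkinDual]
  | cons n b ih =>
    simp only [dynkinDual, shuffleSum_add, ih]
    ring

theorem dynkinDual_const_mul (c : K) (M : List α → K) (a b : List α) :
    dynkinDual (fun w => c * M w) a b = c * dynkinDual M a b := by
  induction b generalizing a with
  | nil => simp [dynkinDual]
  | cons n b ih =>
    simp only [dynkinDual, shuffleSum_const_mul, ih]
    ring

/-- Splitting the vanishing shuffle of `a n` with `b̃ n'` by last letter trades the final letter `n`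
for `n'` at the cost of a sign, so the letters of `b` move one by one to the left part. -/
theorem IsAlternal.neg_one_pow_mul_shuffleSum {M : List α → K} (hM : IsAlternal M) (a : List α)
    (n : α) (b : List α) :
    (-1) ^ b.length * shuffleSum (fun w => M (w ++ [n])) a b.reverse = M (a ++ n :: b) := by
  induction b generalizing a n with
  | nil => simp
  | cons n' b ih =>
    have h := hM.shuffle (a ++ [n]) (b.reverse ++ [n']) (by simp) (by simp)
    rw [shuffleSum_concat_concat] at h
    have h2 := ih (a ++ [n]) n'
    rw [List.append_assoc, List.singleton_append] at h2
    rw [← h2, List.reverse_cons, List.length_cons, pow_succ]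
    linear_combination (-(-1) ^ b.length) * h

/-- Each choice of the marked letter in `b` contributes the same value. -/
theorem IsAlternal.dynkinDual_eq {M : List α → K} (hM : IsAlternal M) (a b : List α) :
    dynkinDual M a b = b.length * M (a ++ b) := by
  induction b generalizing a with
  | nil => simp [dynkinDual]
  | cons n b ih =>
    rw [dynkinDual, ih, hM.neg_one_pow_mul_shuffleSum]
    simp
    ring

/-- The mould which is the inverse of `S` when `S` is symmetral. -/
def mouldAntipode (S : List α → K) (w : List α) : K := (-1) ^ w.length * S w.reverse

theorem IsSymmetral.shuffleSum_concat_add {S : List α → K} (hS : IsSymmetral S) (a : List α)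
    (n n' : α) (b : List α) :
    (-1) ^ (b.length + 1) * shuffleSum (fun w => S (w ++ [n])) a (b.reverse ++ [n']) =
      S (a ++ [n]) * mouldAntipode S (n' :: b) +
        (-1) ^ b.length * shuffleSum (fun w => S (w ++ [n'])) (a ++ [n]) b.reverse := by
  have h := hS.shuffle (a ++ [n]) (b.reverse ++ [n'])
  rw [shuffleSum_concat_concat] at h
  simp only [mouldAntipode, List.reverse_cons, List.length_cons, pow_succ]
  linear_combination (-(-1) ^ b.length) * h

theorem IsSymmetral.mouldMul_antipode_aux {S : List α → K} (hS : IsSymmetral S) (a : List α)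
    (n : α) (b : List α) :
    mouldMul (fun u => S (a ++ n :: u)) (mouldAntipode S) b =
      (-1) ^ b.length * shuffleSum (fun w => S (w ++ [n])) a b.reverse := by
  induction b generalizing a n with
  | nil => simp [mouldAntipode, hS.map_nil]
  | cons n' b ih =>
    have h := ih (a ++ [n]) n'
    simp only [List.append_assoc, List.singleton_append] at h
    rw [mouldMul_cons, h, List.reverse_cons, List.length_cons, hS.shuffleSum_concat_add]

theorem IsSymmetral.mouldMul_antipode {S : List α → K} (hS : IsSymmetral S) (n : α)
    (w : List α) : mouldMul S (mouldAntipode S) (n :: w) = 0 := by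
  have h := hS.mouldMul_antipode_aux [] n w
  simp only [List.nil_append] at h
  rw [mouldMul_cons, h, hS.map_nil]
  simp [mouldAntipode, pow_succ]

/-- For `S` symmetral, `M` given by `M (w n) = S w - φ n S (w n)` and `G` given by
`G (w n) = S w - φ (w n) S (w n)`, this computes `dynkinDual M` as `G × S⁻¹`. -/
theorem IsSymmetral.dynkinDual_eq {S M G : List α → K} (hS : IsSymmetral S) (φ : α → K)
    (hM : ∀ w n, M (w ++ [n]) = S w - φ n * S (w ++ [n]))
    (hG : ∀ w n, G (w ++ [n]) = S w - ((w ++ [n]).map φ).sum * S (w ++ [n]))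
    (a : List α) (n : α) (b : List α) :
    dynkinDual M a (n :: b) =
      mouldMul (fun u => G (a ++ n :: u)) (mouldAntipode S) b + (a.map φ).sum *
        ((-1) ^ b.length * shuffleSum (fun w => S (w ++ [n])) a b.reverse) := by
  -- Symmetrality turns the shuffle of the `S w` part into a product, whose second factor with its
  -- sign is the antipode. The remaining shuffles telescope, and φ(n) is added to the φ-sum of the
  -- accumulator.
  have key : ∀ a n (b : List α), (-1) ^ b.length * shuffleSum (fun w => M (w ++ [n])) a b.reverse =
      S a * mouldAntipode S b -
        φ n * ((-1) ^ b.length * shuffleSum (fun w => S (w ++ [n])) a b.reverse) := by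
    intro a n b
    have : (fun w => M (w ++ [n])) = fun w => S w + (-φ n) * S (w ++ [n]) := by
      funext w; rw [hM]; ring
    rw [this, shuffleSum_add, shuffleSum_const_mul, hS.shuffle, mouldAntipode]
    ring
  induction b generalizing a n with
  | nil =>
    rw [dynkinDual, key]
    simp [dynkinDual, mouldAntipode, hS.map_nil, hG]
    ring
  | cons n' b ih =>
    have h := ih (a ++ [n]) n'
    simp only [List.append_assoc, List.singleton_append] at h
    rw [dynkinDual, key, h, mouldMul_cons, hG, List.reverse_cons, List.length_cons,
      hS.shuffleSum_concat_add]
    simp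
    ring

/-- With G = R × S, the product G × S⁻¹ is R by associativity. The accumulator starts empty, so the
correction term of `IsSymmetral.dynkinDual_eq` vanishes. -/
theorem IsSymmetral.dynkinDual_eq_of_conj {S M R : List α → K} (hS : IsSymmetral S) (φ : α → K)
    (hM : ∀ w n, M (w ++ [n]) = S w - φ n * S (w ++ [n])) (hR0 : R [] = 0)
    (hR : ∀ w n, mouldMul R S (w ++ [n]) = S w - ((w ++ [n]).map φ).sum * S (w ++ [n]))
    {w : List α} (hw : w ≠ []) : dynkinDual M [] w = R w := by
  obtain ⟨n, b, rfl⟩ := List.exists_cons_of_ne_nil hw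
  rw [hS.dynkinDual_eq φ hM hR]
  have h1 := mouldMul_cons (mouldMul R S) (mouldAntipode S) n b
  have h2 := mouldMul_assoc R S (mouldAntipode S) (n :: b)
  rw [mouldMul_eq_left (N := mouldMul S (mouldAntipode S))
    (by simp [hS.map_nil, mouldAntipode])] at h2
  · simp only [mouldMul_nil, hR0, zero_mul, zero_add] at h1
    simp [← h1, h2]
  · intro u hu
    obtain ⟨m, c, rfl⟩ := List.exists_cons_of_ne_nil hu
    exact hS.mouldMul_antipode m c

end Ring

end Moulds

/-! ### Birkhoff factorisation of T over Laurent series, and the moulds R and S. -/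

section Birkhoff

variable {k 𝒩 : Type*} [Field k]

/-- The ring `k[[ε]]` inside `k((ε))`. -/
def regularPart (k : Type*) [Field k] : Subring (LaurentSeries k) where
  carrier := {f | ∀ i < 0, f.coeff i = 0}
  zero_mem' := by intro i _; simp
  one_mem' := by intro i hi; simp [HahnSeries.coeff_one, hi.ne]
  add_mem' hf hg i hi := by simp [hf i hi, hg i hi]
  neg_mem' hf i hi := by simp [hf i hi]
  mul_mem' := by
    intro f g hf hg i hi
    rw [HahnSeries.coeff_mul]
    refine Finset.sum_eq_zero fun p hp => ?_
    obtain ⟨-, -, hp⟩ := Finset.mem_antidiagonal.1 hp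
    rcases lt_or_ge p.1 0 with h | h
    · rw [hf _ h, zero_mul]
    · rw [hg _ (by omega), mul_zero]

/-- The space `ε⁻¹ k[ε⁻¹]` inside `k((ε))`. -/
def polarPart (k : Type*) [Field k] : AddSubgroup (LaurentSeries k) where
  carrier := {f | ∀ i ≥ 0, f.coeff i = 0}
  zero_mem' := by intro i _; simp
  add_mem' hf hg i hi := by simp [hf i hi, hg i hi]
  neg_mem' hf i hi := by simp [hf i hi]

theorem eq_zero_of_mem_regularPart_of_mem_polarPart {f : LaurentSeries k}
    (h : f ∈ regularPart k) (h' : f ∈ polarPart k) : f = 0 := by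
  ext i
  rcases lt_or_ge i 0 with hi | hi
  · simpa using h i hi
  · simpa using h' i hi

theorem coeff_mul_of_mem_polarPart {f g : LaurentSeries k} (hf : f ∈ polarPart k)
    (hg : g ∈ polarPart k) {i : ℤ} (hi : -1 ≤ i) : (f * g).coeff i = 0 := by
  rw [HahnSeries.coeff_mul]
  refine Finset.sum_eq_zero fun p hp => ?_
  obtain ⟨-, -, hp⟩ := Finset.mem_antidiagonal.1 hp
  rcases lt_or_ge p.1 0 with h | h
  · rw [hg p.2 (by omega), mul_zero]
  · rw [hf _ h, zero_mul]

theorem mul_mem_polarPart {f g : LaurentSeries k} (hf : f ∈ polarPart k)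
    (hg : g ∈ polarPart k) : f * g ∈ polarPart k :=
  fun _ hi => coeff_mul_of_mem_polarPart hf hg (by omega)

theorem coeff_zero_mul_of_mem_regularPart {f g : LaurentSeries k} (hf : f ∈ regularPart k)
    (hg : g ∈ regularPart k) : (f * g).coeff 0 = f.coeff 0 * g.coeff 0 := by
  rw [HahnSeries.coeff_mul, Finset.sum_eq_single (0, 0)]
  · intro p hp hp0
    obtain ⟨-, -, hp⟩ := Finset.mem_antidiagonal.1 hp
    rcases lt_trichotomy p.1 0 with h | h | h
    · rw [hf _ h, zero_mul]
    · exact absurd (Prod.ext h (by simp only; omega)) hp0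
    · rw [hg p.2 (by omega), mul_zero]
  · intro h
    rw [Finset.mem_antidiagonal] at h
    simp only [HahnSeries.mem_support, add_zero, and_true, not_and_or, not_not] at h
    rcases h with h | h <;> simp [h]

theorem C_mem_regularPart (c : k) : (HahnSeries.C c : LaurentSeries k) ∈ regularPart k := by
  intro i hi
  simp [HahnSeries.C_apply, HahnSeries.coeff_single_of_ne hi.ne]

theorem piMinus_mem (f : LaurentSeries k) : piMinus f ∈ polarPart k := by
  intro i hi
  exact HahnSeries.coeff_truncLT_of_le hi f

theorem piPlus_mem (f : LaurentSeries k) : piPlus f ∈ regularPart k := by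
  intro i hi
  rw [piPlus, HahnSeries.coeff_sub, piMinus, HahnSeries.coeff_truncLT_of_lt hi, sub_self]

/-- The eigenvalue `φ(w) + r(w) ε` of the derivation `∇` on the words `w`. -/
noncomputable def mouldOmega (φ : 𝒩 → k) (w : List 𝒩) : LaurentSeries k :=
  HahnSeries.C (w.map φ).sum + (w.length : LaurentSeries k) * HahnSeries.single (1 : ℤ) 1

theorem mouldOmega_append (φ : 𝒩 → k) (u v : List 𝒩) :
    mouldOmega φ (u ++ v) = mouldOmega φ u + mouldOmega φ v := by
  simp only [mouldOmega, List.map_append, List.sum_append, List.length_append, map_add,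
    Nat.cast_add]
  ring

theorem mouldOmega_perm (φ : 𝒩 → k) {u v : List 𝒩} (h : u.Perm v) :
    mouldOmega φ u = mouldOmega φ v := by
  rw [mouldOmega, mouldOmega, (h.map φ).sum_eq, h.length_eq]

@[simp]
theorem mouldOmega_nil (φ : 𝒩 → k) : mouldOmega φ [] = 0 := by
  simp [mouldOmega]

theorem coeff_mouldOmega_mul (φ : 𝒩 → k) (w : List 𝒩) (f : LaurentSeries k) (i : ℤ) :
    (mouldOmega φ w * f).coeff i = (w.map φ).sum * f.coeff i + w.length * f.coeff (i - 1) := by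
  have h : (HahnSeries.single (1 : ℤ) (1 : k) * f).coeff i = f.coeff (i - 1) := by
    have := HahnSeries.coeff_single_mul_add (r := (1 : k)) (x := f) (a := i - 1) (b := 1)
    simpa using this
  rw [mouldOmega, add_mul, HahnSeries.coeff_add, HahnSeries.C_mul_eq_smul, HahnSeries.coeff_smul,
    mul_assoc, ← nsmul_eq_mul, HahnSeries.coeff_nsmul, Pi.smul_apply, h, nsmul_eq_mul, smul_eq_mul]

/-- The coefficient of ε is the length of `w`, nonzero in characteristic 0; this is how ε
regularises the small divisors φ(w) = 0. -/
theorem mouldOmega_ne_zero [CharZero k] (φ : 𝒩 → k) {w : List 𝒩} (hw : w ≠ []) :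
    mouldOmega φ w ≠ 0 := by
  intro h
  have := coeff_mouldOmega_mul φ w 1 1
  rw [h] at this
  rw [zero_mul, HahnSeries.coeff_zero, HahnSeries.coeff_one, HahnSeries.coeff_one] at this
  simp only [one_ne_zero, if_false, sub_self, if_true, mul_zero, mul_one, zero_add] at this
  exact hw (List.length_eq_zero_iff.1 (Nat.cast_eq_zero.1 this.symm))

section MouldT

variable (φ : 𝒩 → k)

@[simp]
theorem mouldT_nil : mouldT φ [] = 1 := by
  simp [mouldT]

theorem mouldT_concat (w : List 𝒩) (n : 𝒩) :
    mouldT φ (w ++ [n]) = (mouldOmega φ (w ++ [n]))⁻¹ * mouldT φ w := by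
  rw [mouldT, List.length_append, List.length_singleton, Finset.prod_Icc_succ_top (by omega),
    mul_comm]
  congr 1
  · rw [List.take_of_length_le (by simp), mouldOmega]
    simp
  · refine Finset.prod_congr rfl fun j hj => ?_
    rw [List.take_append_of_le_length (Finset.mem_Icc.1 hj).2]

theorem mouldOmega_mul_mouldT [CharZero k] (w : List 𝒩) (n : 𝒩) :
    mouldOmega φ (w ++ [n]) * mouldT φ (w ++ [n]) = mouldT φ w := by
  rw [mouldT_concat, mul_inv_cancel_left₀ (mouldOmega_ne_zero φ (by simp))]

/-- All words in a shuffle are permutations of one another and share the same ω. Splitting by last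
letter factors it out, and induction reduces the claim to ω(uv) = ω(u) + ω(v). -/
theorem isSymmetral_mouldT [CharZero k] : IsSymmetral (mouldT φ) where
  map_nil := mouldT_nil φ
  shuffle u v := by
    induction u using List.reverseRecOn generalizing v with
    | nil => simp
    | append_singleton u a ihu =>
      induction v using List.reverseRecOn with
      | nil => simp
      | append_singleton v b ihv =>
        have key : ∀ (u' v' : List 𝒩) (n : 𝒩), (u' ++ v' ++ [n]).Perm (u ++ [a] ++ (v ++ [b])) →
            shuffleSum (fun w => mouldT φ (w ++ [n])) u' v' =
              (mouldOmega φ (u ++ [a] ++ (v ++ [b])))⁻¹ * shuffleSum (mouldT φ) u' v' := by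
          intro u' v' n h
          rw [← shuffleSum_const_mul]
          refine shuffleSum_congr fun w hw => ?_
          rw [mouldT_concat, mouldOmega_perm φ ((hw.append_right [n]).trans h)]
        have hne := mouldOmega_ne_zero φ (w := u ++ [a] ++ (v ++ [b])) (by simp)
        rw [shuffleSum_concat_concat, key u (v ++ [b]) a, key (u ++ [a]) v b, ihu, ihv,
          ← mul_add, inv_mul_eq_iff_eq_mul₀ hne, mouldOmega_append]
        · linear_combination (-mouldT φ (v ++ [b])) * mouldOmega_mul_mouldT φ u a -
            mouldT φ (u ++ [a]) * mouldOmega_mul_mouldT φ v b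
        · simp
        · simp only [List.append_assoc]
          refine List.Perm.append_left u ?_
          rw [← List.append_assoc]
          exact List.perm_append_comm

end MouldT

variable (φ : 𝒩 → k)

theorem mouldUMinus_mem {w : List 𝒩} (hw : w ≠ []) : mouldUMinus φ w ∈ polarPart k := by
  rw [mouldUMinus_of_ne_nil φ hw]
  exact neg_mem (piMinus_mem _)

theorem mouldUPlus_mem (w : List 𝒩) : mouldUPlus φ w ∈ regularPart k := by
  cases w with
  | nil => exact one_mem _
  | cons n w => exact piPlus_mem _

theorem mouldUPlus_eq_mouldMul : mouldUPlus φ = mouldMul (mouldUMinus φ) (mouldT φ) := by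
  funext w
  cases w with
  | nil => simp [mouldUPlus, mouldUMinus_nil]
  | cons n w =>
    rw [mouldMul_eq_sum, Finset.sum_range_succ]
    have := mouldUMinus_of_ne_nil φ (w := n :: w) (by simp)
    simp only [List.take_length, List.drop_length, mouldT_nil, mul_one, this, mouldUPlus, piPlus]
    rw [mouldD, ← Fin.sum_univ_eq_sum_range
      (fun i => mouldUMinus φ ((n :: w).take i) * mouldT φ ((n :: w).drop i))]
    ring

/-- By induction and symmetrality of T, the defects of U₋ and U₊ at (u, v) coincide. For nonempty
words the first is polar and the second regular, so both vanish. -/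
theorem isSymmetral_mouldUMinus [CharZero k] : IsSymmetral (mouldUMinus φ) where
  map_nil := mouldUMinus_nil φ
  shuffle u v := by
    induction h : u.length + v.length using Nat.strong_induction_on generalizing u v with
    | _ r ih =>
      subst h
      rcases eq_or_ne u [] with rfl | hu
      · simp [mouldUMinus_nil]
      rcases eq_or_ne v [] with rfl | hv
      · simp [mouldUMinus_nil]
      have key := shuffleSum_mouldMul_sub (isSymmetral_mouldT φ) u v
        (fun a b hab => ih _ hab a b rfl)
      rw [← mouldUPlus_eq_mouldMul] at key
      rw [← sub_eq_zero]
      refine eq_zero_of_mem_regularPart_of_mem_polarPart ?_ ?_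
      · rw [← key]
        exact sub_mem (shuffleSum_mem (regularPart k).toAddSubgroup
          fun w _ => mouldUPlus_mem φ w) (mul_mem (mouldUPlus_mem φ u) (mouldUPlus_mem φ v))
      · refine sub_mem (shuffleSum_mem _ fun w hw => mouldUMinus_mem φ ?_)
          (mul_mem_polarPart (mouldUMinus_mem φ hu) (mouldUMinus_mem φ hv))
        rintro rfl
        exact hu (List.append_eq_nil_iff.1 (List.nil_perm.1 hw)).1

theorem isSymmetral_mouldUPlus [CharZero k] : IsSymmetral (mouldUPlus φ) where
  map_nil := by rw [mouldUPlus]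
  shuffle u v := by
    have key := shuffleSum_mouldMul_sub (isSymmetral_mouldT φ) u v
        (fun a b _ => (isSymmetral_mouldUMinus φ).shuffle a b)
    rw [(isSymmetral_mouldUMinus φ).shuffle, sub_self, ← mouldUPlus_eq_mouldMul] at key
    exact sub_eq_zero.1 key

/-- The extraction of a coefficient as an additive map. -/
def laurentCoeff (k : Type*) [Field k] (i : ℤ) : LaurentSeries k →+ k where
  toFun f := f.coeff i
  map_zero' := by simp
  map_add' f g := by simp

theorem isSymmetral_mouldS [CharZero k] : IsSymmetral (mouldS φ) where
  map_nil := by simp [mouldS, mouldUPlus]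
  shuffle u v := by
    have h := shuffleSum_map (laurentCoeff k 0) (mouldUPlus φ) u v
    rw [(isSymmetral_mouldUPlus φ).shuffle] at h
    exact h.trans (coeff_zero_mul_of_mem_regularPart (mouldUPlus_mem φ u) (mouldUPlus_mem φ v))

/-- A product of two polar series has no residue, and the length factor is constant along a shuffle.
-/
theorem isAlternal_mouldR [CharZero k] : IsAlternal (mouldR φ) where
  map_nil := by simp [mouldR]
  shuffle u v hu hv := by
    have h1 : shuffleSum (mouldR φ) u v =
        shuffleSum (fun w => -((u ++ v).length : k) * (mouldUMinus φ w).coeff (-1)) u v :=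
      shuffleSum_congr fun w hw => by rw [mouldR, hw.length_eq]
    have h2 := shuffleSum_map (laurentCoeff k (-1)) (mouldUMinus φ) u v
    have h3 : laurentCoeff k (-1) (mouldUMinus φ u * mouldUMinus φ v) = 0 :=
      coeff_mul_of_mem_polarPart (mouldUMinus_mem φ hu) (mouldUMinus_mem φ hv) le_rfl
    rw [(isSymmetral_mouldUMinus φ).shuffle, h3] at h2
    rw [h1, shuffleSum_const_mul]
    exact (congrArg _ h2).trans (mul_zero _)

/-- The mould `R` as a mould with constant values in `k((ε))`. -/
noncomputable def mouldCR (w : List 𝒩) : LaurentSeries k := HahnSeries.C (mouldR φ w)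

theorem coeff_mouldMul_mouldUMinus (M : List 𝒩 → k) (w : List 𝒩) {i : ℤ} (hi : 0 ≤ i) :
    (mouldMul (fun u => (HahnSeries.C (M u) : LaurentSeries k)) (mouldUMinus φ) w).coeff i =
      (HahnSeries.C (M w) : LaurentSeries k).coeff i := by
  induction w generalizing M with
  | nil => simp [mouldUMinus_nil]
  | cons n w ih =>
    rw [mouldMul_cons, HahnSeries.coeff_add, ih (fun u => M (n :: u)), HahnSeries.C_mul_eq_smul,
      HahnSeries.coeff_smul, mouldUMinus_mem φ (by simp) i hi, smul_zero, zero_add]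

/-- Let E = ωU₋ + R × U₋. If E vanishes on shorter words, then E(w) = (E × T)(w), which the
derivation rule rewrites in terms of U₊, hence as a regular series. But E(w) is also polar, R being
chosen to cancel its constant term. -/
theorem mouldOmega_mul_mouldUMinus [CharZero k] (w : List 𝒩) :
    mouldOmega φ w * mouldUMinus φ w = -mouldMul (mouldCR φ) (mouldUMinus φ) w := by
  rw [← add_eq_zero_iff_eq_neg]
  induction h : w.length using Nat.strong_induction_on generalizing w with
  | _ r ih =>
    subst h
    rcases List.eq_nil_or_concat' w with rfl | ⟨w, n, rfl⟩
    · simp [mouldCR, mouldR]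
    have h1 := mouldMul_eq_of_forall_lt (mouldT_nil φ) (w := w ++ [n])
      (M := fun u => mouldOmega φ u * mouldUMinus φ u + mouldMul (mouldCR φ) (mouldUMinus φ) u)
      (fun u hu => ih _ hu u rfl)
    have h2 := mul_mouldMul (mouldOmega_append φ) (mouldUMinus φ) (mouldT φ) (w ++ [n])
    have h3 := mouldMul_concat (mouldUMinus φ) (fun u => mouldOmega φ u * mouldT φ u) n w
    simp only [mouldOmega_mul_mouldT, mouldOmega_nil, zero_mul, mul_zero, add_zero] at h3
    rw [mouldMul_add_left, mouldMul_assoc, ← mouldUPlus_eq_mouldMul] at h1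
    rw [h3, ← mouldUPlus_eq_mouldMul] at h2
    have hε : mouldOmega φ (w ++ [n]) ∈ regularPart k := by
      intro i hi
      have := coeff_mouldOmega_mul φ (w ++ [n]) 1 i
      rw [mul_one] at this
      rw [this, HahnSeries.coeff_one, HahnSeries.coeff_one, if_neg (by omega), if_neg (by omega)]
      simp
    refine eq_zero_of_mem_regularPart_of_mem_polarPart ?_ ?_
    · rw [← h1, ← sub_eq_iff_eq_add.2 h2]
      exact add_mem (sub_mem (mul_mem hε (mouldUPlus_mem φ _)) (mouldUPlus_mem φ _))
        (mouldMul_mem _ (fun u => C_mem_regularPart _) (mouldUPlus_mem φ) _)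
    · intro i hi
      have := coeff_mouldMul_mouldUMinus φ (mouldR φ) (w ++ [n]) hi
      rw [HahnSeries.coeff_add, coeff_mouldOmega_mul, mouldUMinus_mem φ (by simp) i hi]
      refine (congrArg _ this).trans ?_
      rcases hi.eq_or_lt with rfl | hi
      · simp [mouldR]
        ring
      · rw [mouldUMinus_mem φ (by simp) (i - 1) (by omega), HahnSeries.C_apply,
          HahnSeries.coeff_single_of_ne hi.ne']
        simp

/-- Apply the derivation ω to U₊ = U₋ × T and use the equations for ωU₋ and ωT. -/
theorem mouldOmega_mul_mouldUPlus [CharZero k] (w : List 𝒩) (n : 𝒩) :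
    mouldOmega φ (w ++ [n]) * mouldUPlus φ (w ++ [n]) =
      mouldUPlus φ w - mouldMul (mouldCR φ) (mouldUPlus φ) (w ++ [n]) := by
  have h3 := mouldMul_concat (mouldUMinus φ) (fun u => mouldOmega φ u * mouldT φ u) n w
  simp only [mouldOmega_mul_mouldT, mouldOmega_nil, zero_mul, mul_zero, add_zero] at h3
  have h4 : (fun u => mouldOmega φ u * mouldUMinus φ u) =
      fun u => (-1) * mouldMul (mouldCR φ) (mouldUMinus φ) u := by
    funext u
    rw [mouldOmega_mul_mouldUMinus, neg_one_mul]
  rw [mouldUPlus_eq_mouldMul, mul_mouldMul (mouldOmega_append φ), h3, h4, mouldMul_const_mul_left,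
    mouldMul_assoc]
  ring

theorem coeff_zero_mouldMul_mouldUPlus (M : List 𝒩 → k) (w : List 𝒩) :
    (mouldMul (fun u => (HahnSeries.C (M u) : LaurentSeries k)) (mouldUPlus φ) w).coeff 0 =
      mouldMul M (mouldS φ) w := by
  induction w generalizing M with
  | nil => simp [mouldUPlus, mouldS]
  | cons n w ih =>
    rw [mouldMul_cons, HahnSeries.coeff_add, ih (fun u => M (n :: u)), HahnSeries.C_mul_eq_smul,
      HahnSeries.coeff_smul, mouldMul_cons]
    rfl

/-- The mould form of the conjugacy equation. -/
theorem mouldMul_mouldR_mouldS [CharZero k] (w : List 𝒩) (n : 𝒩) :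
    mouldMul (mouldR φ) (mouldS φ) (w ++ [n]) =
      mouldS φ w - ((w ++ [n]).map φ).sum * mouldS φ (w ++ [n]) := by
  have h := congrArg (fun f : LaurentSeries k => f.coeff 0) (mouldOmega_mul_mouldUPlus φ w n)
  simp only [coeff_mouldOmega_mul, HahnSeries.coeff_sub] at h
  rw [mouldUPlus_mem φ _ (0 - 1) (by omega), mul_zero, add_zero] at h
  have h2 := coeff_zero_mouldMul_mouldUPlus φ (mouldR φ) (w ++ [n])
  rw [mouldS, mouldS, h, ← h2]
  rw [sub_sub_cancel]
  rfl

/-- A Laurent polynomial with polar terms only which is annihilated, up to a constant, by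
`c + r ε` with `c ≠ 0`, is zero. -/
theorem eq_zero_of_mouldOmega_mul {w : List 𝒩} (hw : (w.map φ).sum ≠ 0) {f : LaurentSeries k}
    (hf : f ∈ polarPart k) (h : mouldOmega φ w * f ∈ regularPart k) : f = 0 := by
  by_contra hne
  have hlt : f.order < 0 := by
    by_contra hge
    exact hne (HahnSeries.coeff_order_eq_zero.1 (hf _ (not_lt.1 hge)))
  -- At the order of `f`, multiplication by ε contributes nothing, so this coefficient is φ(w) times
  -- the leading coefficient.
  have := h _ hlt
  rw [coeff_mouldOmega_mul, HahnSeries.coeff_eq_zero_of_lt_order (show f.order - 1 < f.order by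
    omega), mul_zero, add_zero] at this
  exact mul_ne_zero hw (mt HahnSeries.coeff_order_eq_zero.1 hne) this

/-- In ωU₋ = -R × U₋, a proper cut w = ab has φ(a) ≠ 0 or φ(b) ≠ 0, so its term vanishes by
induction. Only the constant R(w) is left, hence ω(w)U₋(w) is regular. -/
theorem mouldUMinus_eq_zero [CharZero k] {w : List 𝒩} (hw : (w.map φ).sum ≠ 0) :
    mouldUMinus φ w = 0 := by
  induction h : w.length using Nat.strong_induction_on generalizing w with
  | _ r ih =>
    subst h
    have hne : w ≠ [] := by rintro rfl; simp at hw
    refine eq_zero_of_mouldOmega_mul φ hw (mouldUMinus_mem φ hne) ?_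
    rw [mouldOmega_mul_mouldUMinus, mouldMul_eq_sum]
    refine neg_mem (sum_mem fun i hi => ?_)
    by_cases hi0 : i = 0
    · subst hi0
      simp [mouldCR, mouldR]
    by_cases hil : i = w.length
    · subst hil
      rw [List.take_length, List.drop_length, mouldUMinus_nil, mul_one]
      exact C_mem_regularPart (mouldR φ w)
    have hil' : i < w.length := by
      have := Finset.mem_range.1 hi
      omega
    have hs : ((w.take i).map φ).sum + ((w.drop i).map φ).sum = (w.map φ).sum := by
      rw [← List.sum_append, ← List.map_append, List.take_append_drop]
    by_cases h1 : ((w.take i).map φ).sum = 0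
    · have h2 : ((w.drop i).map φ).sum ≠ 0 := by
        rw [h1, zero_add] at hs
        rwa [hs]
      rw [ih _ (by rw [List.length_drop]; omega) h2 rfl, mul_zero]
      exact zero_mem _
    · rw [mouldCR, mouldR, ih _ (by rw [List.length_take]; omega) h1 rfl]
      simp

theorem sum_mul_mouldR [CharZero k] (w : List 𝒩) : (w.map φ).sum * mouldR φ w = 0 := by
  by_cases hw : (w.map φ).sum = 0
  · rw [hw, zero_mul]
  · simp [mouldR, mouldUMinus_eq_zero φ hw]

/-- The coefficients of the expansion of `Ψ (X₀ + B) - X₀` on the nested brackets. -/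
noncomputable def mouldConj (w : List 𝒩) : k :=
  -- The default 0 concerns only the empty word, whose value plays no role.
  mouldS φ w.dropLast - (w.getLast?.map φ).getD 0 * mouldS φ w

theorem mouldConj_concat (w : List 𝒩) (n : 𝒩) :
    mouldConj φ (w ++ [n]) = mouldS φ w - φ n * mouldS φ (w ++ [n]) := by
  simp [mouldConj]

theorem dynkinDual_mouldConj [CharZero k] {w : List 𝒩} (hw : w ≠ []) :
    dynkinDual (mouldConj φ) [] w = mouldR φ w :=
  (isSymmetral_mouldS φ).dynkinDual_eq_of_conj φ (mouldConj_concat φ) (isAlternal_mouldR φ).map_nil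
    (mouldMul_mouldR_mouldS φ) hw

end Birkhoff

/-! ### Finite sums over words. -/

section Words

variable {α : Type*}

/-- The words of length `r` on the finite alphabet `A`. -/
def wordsOfLength (A : Finset α) : ℕ → Finset (List α)
  | 0 => {[]}
  | r + 1 => (A ×ˢ wordsOfLength A r).map
      ⟨fun p => p.1 :: p.2, fun _ _ h => Prod.ext (List.cons.inj h).1 (List.cons.inj h).2⟩

theorem mem_wordsOfLength {A : Finset α} {r : ℕ} {w : List α} :
    w ∈ wordsOfLength A r ↔ w.length = r ∧ ∀ n ∈ w, n ∈ A := by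
  induction r generalizing w with
  | zero =>
    rw [wordsOfLength, Finset.mem_singleton, List.length_eq_zero_iff]
    constructor
    · rintro rfl; simp
    · exact fun h => h.1
  | succ r ih =>
    simp only [wordsOfLength, Finset.mem_map, Finset.mem_product, Prod.exists,
      ih, DFunLike.coe]
    cases w with
    | nil => simp
    | cons n w => simp [and_assoc, and_left_comm]

variable {M : Type*} [AddCommMonoid M] (A : Finset α)

@[simp]
theorem sum_wordsOfLength_zero (f : List α → M) : ∑ w ∈ wordsOfLength A 0, f w = f [] := by
  simp [wordsOfLength]

theorem sum_wordsOfLength_succ (r : ℕ) (f : List α → M) :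
    ∑ w ∈ wordsOfLength A (r + 1), f w = ∑ n ∈ A, ∑ w ∈ wordsOfLength A r, f (n :: w) := by
  rw [wordsOfLength, Finset.sum_map, Finset.sum_product]
  rfl

theorem sum_wordsOfLength_succ' (r : ℕ) (f : List α → M) :
    ∑ w ∈ wordsOfLength A (r + 1), f w = ∑ w ∈ wordsOfLength A r, ∑ n ∈ A, f (w ++ [n]) := by
  induction r generalizing f with
  | zero => simp [sum_wordsOfLength_succ]
  | succ r ih =>
    rw [sum_wordsOfLength_succ, sum_wordsOfLength_succ]
    exact Finset.sum_congr rfl fun n _ => ih _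

open Classical in
/-- The words of length `< m` on the finite alphabet `A`. -/
noncomputable def wordsBelow (m : ℕ) : Finset (List α) :=
  (Finset.range m).biUnion (wordsOfLength A)

theorem mem_wordsBelow {m : ℕ} {w : List α} :
    w ∈ wordsBelow A m ↔ w.length < m ∧ ∀ n ∈ w, n ∈ A := by
  simp [wordsBelow, mem_wordsOfLength]

theorem sum_wordsBelow (m : ℕ) (f : List α → M) :
    ∑ w ∈ wordsBelow A m, f w = ∑ r ∈ Finset.range m, ∑ w ∈ wordsOfLength A r, f w := by
  classical
  refine Finset.sum_biUnion fun r _ s _ hrs => ?_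
  rw [Function.onFun, Finset.disjoint_left]
  intro w hr hs
  exact hrs ((mem_wordsOfLength.1 hr).1.symm.trans (mem_wordsOfLength.1 hs).1)

end Words

/-! ### Nested brackets, the Dynkin identity and the Leibniz rule. -/

section Dynkin

variable {k L 𝒩 : Type*} [Field k] [LieRing L] [LieAlgebra k L]

@[simp]
theorem adWord_nil (B : 𝒩 → L) : adWord k B [] = 1 := rfl

theorem adWord_cons (B : 𝒩 → L) (n : 𝒩) (w : List 𝒩) :
    adWord k B (n :: w) = LieAlgebra.ad k L (B n) * adWord k B w := by
  simp [adWord]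

theorem adWord_concat (B : 𝒩 → L) (n : 𝒩) (w : List 𝒩) :
    adWord k B (w ++ [n]) = adWord k B w * LieAlgebra.ad k L (B n) := by
  simp [adWord]

theorem nestedBracket_cons (B : 𝒩 → L) (n : 𝒩) {w : List 𝒩} (hw : w ≠ []) :
    nestedBracket B (n :: w) = ⁅B n, nestedBracket B w⁆ := by
  obtain ⟨n', w, rfl⟩ := List.exists_cons_of_ne_nil hw
  rw [nestedBracket]

theorem nestedBracket_concat (B : 𝒩 → L) (n : 𝒩) (w : List 𝒩) :
    nestedBracket B (w ++ [n]) = adWord k B w (B n) := by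
  induction w with
  | nil => rfl
  | cons a w ih =>
    rw [List.cons_append, nestedBracket_cons B a (by simp), ih, adWord_cons]
    rfl

-- Commutator brackets, so that `nestedBracket` makes sense in associative algebras.
attribute [local instance] LieRing.ofAssociativeRing

theorem ad_nestedBracket (B : 𝒩 → L) (w : List 𝒩) : LieAlgebra.ad k L (nestedBracket B w) =
    nestedBracket (fun n => LieAlgebra.ad k L (B n)) w := by
  induction w with
  | nil => exact map_zero _
  | cons n w ih =>
    rcases eq_or_ne w [] with rfl | hw
    · rfl
    · rw [nestedBracket_cons B n hw, nestedBracket_cons _ n hw, LieHom.map_lie, ih]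

variable (A : Finset 𝒩)

/-- In an associative algebra, the iterated commutators expand according to `dynkinDual`. -/
theorem sum_smul_nestedBracket_assoc {E : Type*} [Ring E] [Algebra k E] (b : 𝒩 → E) (r : ℕ)
    (c : List 𝒩 → k) :
    ∑ w ∈ wordsOfLength A (r + 1), c w • nestedBracket b w =
      ∑ w ∈ wordsOfLength A (r + 1), dynkinDual c [] w • (w.map b).prod := by
  induction r generalizing c with
  | zero => simp [sum_wordsOfLength_succ, dynkinDual, nestedBracket]
  | succ r ih =>
    have h1 : ∑ w ∈ wordsOfLength A (r + 1 + 1), c w • nestedBracket b w =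
        ∑ n ∈ A, ∑ w ∈ wordsOfLength A (r + 1),
          c (n :: w) • (b n * nestedBracket b w - nestedBracket b w * b n) := by
      rw [sum_wordsOfLength_succ]
      refine Finset.sum_congr rfl fun n _ => Finset.sum_congr rfl fun w hw => ?_
      rw [nestedBracket_cons, Ring.lie_def]
      rintro rfl
      simp [mem_wordsOfLength] at hw
    have h2 : ∀ n, ∑ w ∈ wordsOfLength A (r + 1),
        c (n :: w) • (b n * nestedBracket b w - nestedBracket b w * b n) =
          b n * ∑ w ∈ wordsOfLength A (r + 1),
              dynkinDual (fun u => c (n :: u)) [] w • (w.map b).prod -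
            (∑ w ∈ wordsOfLength A (r + 1),
              dynkinDual (fun u => c (n :: u)) [] w • (w.map b).prod) * b n := by
      intro n
      rw [← ih, Finset.mul_sum, Finset.sum_mul, ← Finset.sum_sub_distrib]
      refine Finset.sum_congr rfl fun w _ => ?_
      rw [smul_sub, mul_smul_comm, smul_mul_assoc]
    have h3 : ∑ w ∈ wordsOfLength A (r + 1 + 1), dynkinDual c [] w • (w.map b).prod =
        ∑ x ∈ A, ∑ u ∈ wordsOfLength A r, ∑ y ∈ A,
          (dynkinDual (fun w => c (x :: w)) [] (u ++ [y]) -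
            dynkinDual (fun w => c (y :: w)) [] (x :: u)) • (b x * (u.map b).prod * b y) := by
      rw [sum_wordsOfLength_succ]
      refine Finset.sum_congr rfl fun x _ => ?_
      rw [sum_wordsOfLength_succ']
      refine Finset.sum_congr rfl fun u _ => Finset.sum_congr rfl fun y _ => ?_
      rw [dynkinDual_nil_cons_concat]
      simp [mul_assoc]
    rw [h1, Finset.sum_congr rfl fun n _ => h2 n, h3, Finset.sum_sub_distrib]
    simp only [sub_smul, Finset.sum_sub_distrib]
    congr 1
    · refine Finset.sum_congr rfl fun x _ => ?_
      rw [sum_wordsOfLength_succ', Finset.mul_sum]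
      refine Finset.sum_congr rfl fun u _ => ?_
      rw [Finset.mul_sum]
      refine Finset.sum_congr rfl fun y _ => ?_
      simp [mul_assoc]
    · have h4 : ∀ y ∈ A, (∑ w ∈ wordsOfLength A (r + 1),
          dynkinDual (fun u => c (y :: u)) [] w • (w.map b).prod) * b y =
          ∑ x ∈ A, ∑ u ∈ wordsOfLength A r,
            dynkinDual (fun w => c (y :: w)) [] (x :: u) • (b x * (u.map b).prod * b y) := by
        intro y _
        rw [sum_wordsOfLength_succ, Finset.sum_mul]
        refine Finset.sum_congr rfl fun x _ => ?_
        rw [Finset.sum_mul]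
        refine Finset.sum_congr rfl fun u _ => ?_
        simp
      rw [Finset.sum_congr rfl h4, Finset.sum_comm]
      exact Finset.sum_congr rfl fun x _ => Finset.sum_comm

/-- Since `ad` is a Lie morphism, the associative expansion can be carried out in `Module.End k L`;
no enveloping algebra is needed. -/
theorem sum_smul_ad_nestedBracket (B : 𝒩 → L) (r : ℕ) (c : List 𝒩 → k) (X : L) :
    ∑ w ∈ wordsOfLength A (r + 1), dynkinDual c [] w • adWord k B w X =
      ∑ w ∈ wordsOfLength A (r + 1), c w • ⁅nestedBracket B w, X⁆ := by
  have h := sum_smul_nestedBracket_assoc A (fun n => LieAlgebra.ad k L (B n)) r c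
  have h' := congrArg (fun f : Module.End k L => f X) h
  simp only [LinearMap.sum_apply, LinearMap.smul_apply, ← ad_nestedBracket,
    LieAlgebra.ad_apply] at h'
  exact h'.symm

/-- The Dynkin–Specht–Wever identity, in dual form. -/
theorem sum_dynkinDual_smul_nestedBracket (B : 𝒩 → L) (r : ℕ) (c : List 𝒩 → k) :
    ∑ w ∈ wordsOfLength A (r + 1), dynkinDual c [] w • nestedBracket B w =
      ((r + 1 : ℕ) : k) • ∑ w ∈ wordsOfLength A (r + 1), c w • nestedBracket B w := by
  induction r generalizing c with
  | zero => simp [sum_wordsOfLength_succ, dynkinDual, nestedBracket]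
  | succ r ih =>
    have hne : ∀ w ∈ wordsOfLength A (r + 1), w ≠ [] := by
      rintro w hw rfl
      simp [mem_wordsOfLength] at hw
    have h3 : ∑ w ∈ wordsOfLength A (r + 1 + 1), dynkinDual c [] w • nestedBracket B w =
        ∑ x ∈ A, ∑ u ∈ wordsOfLength A r, ∑ y ∈ A,
          (dynkinDual (fun w => c (x :: w)) [] (u ++ [y]) -
            dynkinDual (fun w => c (y :: w)) [] (x :: u)) • nestedBracket B (x :: (u ++ [y])) := by
      rw [sum_wordsOfLength_succ]
      refine Finset.sum_congr rfl fun x _ => ?_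
      rw [sum_wordsOfLength_succ']
      refine Finset.sum_congr rfl fun u _ => Finset.sum_congr rfl fun y _ => ?_
      rw [dynkinDual_nil_cons_concat]
    -- The part where the outer letter stays first is the bracket of `B x` with the induction
    -- hypothesis, giving `r + 1` copies.
    have h1 : ∑ x ∈ A, ∑ u ∈ wordsOfLength A r, ∑ y ∈ A,
        dynkinDual (fun w => c (x :: w)) [] (u ++ [y]) • nestedBracket B (x :: (u ++ [y])) =
        ((r + 1 : ℕ) : k) • ∑ w ∈ wordsOfLength A (r + 1 + 1), c w • nestedBracket B w := by
      rw [sum_wordsOfLength_succ, Finset.smul_sum]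
      refine Finset.sum_congr rfl fun x _ => ?_
      have := congrArg (fun Y => ⁅B x, Y⁆) (ih (fun w => c (x :: w)))
      simp only [lie_sum, lie_smul] at this
      rw [← sum_wordsOfLength_succ' A r
        (fun w => dynkinDual (fun w => c (x :: w)) [] w • nestedBracket B (x :: w))]
      calc _ = _ := Finset.sum_congr rfl fun w hw => by rw [nestedBracket_cons B x (hne w hw)]
        _ = _ := this
        _ = _ := by
          congr 1
          exact Finset.sum_congr rfl fun w hw => by rw [nestedBracket_cons B x (hne w hw)]
    -- The part where it goes last is an expansion of the inner bracket acting by `ad` on `B y`;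
    -- skew-symmetry makes it the missing copy.
    have h2 : ∑ x ∈ A, ∑ u ∈ wordsOfLength A r, ∑ y ∈ A,
        dynkinDual (fun w => c (y :: w)) [] (x :: u) • nestedBracket B (x :: (u ++ [y])) =
        -∑ w ∈ wordsOfLength A (r + 1 + 1), c w • nestedBracket B w := by
      calc _ = ∑ y ∈ A, ∑ w ∈ wordsOfLength A (r + 1),
            dynkinDual (fun w => c (y :: w)) [] w • adWord k B w (B y) := by
            rw [Finset.sum_congr rfl fun x _ => Finset.sum_comm, Finset.sum_comm]
            refine Finset.sum_congr rfl fun y _ => ?_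
            rw [sum_wordsOfLength_succ]
            refine Finset.sum_congr rfl fun x _ => Finset.sum_congr rfl fun u _ => ?_
            rw [← List.cons_append, nestedBracket_concat (k := k)]
        _ = ∑ y ∈ A, ∑ w ∈ wordsOfLength A (r + 1), c (y :: w) • ⁅nestedBracket B w, B y⁆ :=
            Finset.sum_congr rfl fun y _ => sum_smul_ad_nestedBracket A B r _ _
        _ = _ := by
            rw [sum_wordsOfLength_succ, ← Finset.sum_neg_distrib]
            refine Finset.sum_congr rfl fun y _ => ?_
            rw [← Finset.sum_neg_distrib]
            refine Finset.sum_congr rfl fun w hw => ?_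
            rw [nestedBracket_cons B y (hne w hw), ← lie_skew (B y), smul_neg, neg_neg]
    rw [h3]
    simp only [sub_smul, Finset.sum_sub_distrib]
    rw [h1, h2, sub_neg_eq_add, Nat.cast_succ (r + 1), add_smul, one_smul]

/-- A relation between iterated brackets follows from its dual form. -/
theorem sum_smul_nestedBracket_eq_zero [CharZero k] (B : 𝒩 → L) (r : ℕ) {c : List 𝒩 → k}
    (hc : ∀ w, w.length = r → w ≠ [] → dynkinDual c [] w = 0) :
    ∑ w ∈ wordsOfLength A r, c w • nestedBracket B w = 0 := by
  cases r with
  | zero => simp [nestedBracket]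
  | succ r =>
    have h := sum_dynkinDual_smul_nestedBracket A B r c
    rw [Finset.sum_eq_zero] at h
    · exact (smul_eq_zero.1 h.symm).resolve_left (Nat.cast_ne_zero.2 r.succ_ne_zero)
    · intro w hw
      have hl := (mem_wordsOfLength.1 hw).1
      rw [hc w hl (by rintro rfl; simp at hl), zero_smul]

/-- The Leibniz rule for the operators `ad_{B_w}`. -/
theorem sum_smul_adWord_lie (B : 𝒩 → L) (c : List 𝒩 → k) (r : ℕ) (X Y : L) :
    ∑ w ∈ wordsOfLength A r, c w • adWord k B w ⁅X, Y⁆ =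
      ∑ p ∈ Finset.HasAntidiagonal.antidiagonal r, ∑ u ∈ wordsOfLength A p.1, ∑ v ∈ wordsOfLength A p.2,
        shuffleSum c u v • ⁅adWord k B u X, adWord k B v Y⁆ := by
  induction r generalizing c with
  | zero => simp
  | succ r ih =>
    -- `H₁` and `H₂` collect the terms whose first letter acts on `X`, respectively on `Y`.
    set H : ℕ → ℕ → L := fun i j => ∑ u ∈ wordsOfLength A i, ∑ v ∈ wordsOfLength A j,
        shuffleSum c u v • ⁅adWord k B u X, adWord k B v Y⁆ with hH
    set H₁ : ℕ → ℕ → L := fun i j => ∑ n ∈ A, ∑ u ∈ wordsOfLength A i, ∑ v ∈ wordsOfLength A j,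
        shuffleSum (fun w => c (n :: w)) u v • ⁅adWord k B (n :: u) X, adWord k B v Y⁆ with hH₁
    set H₂ : ℕ → ℕ → L := fun i j => ∑ n ∈ A, ∑ u ∈ wordsOfLength A i, ∑ v ∈ wordsOfLength A j,
        shuffleSum (fun w => c (n :: w)) u v • ⁅adWord k B u X, adWord k B (n :: v) Y⁆ with hH₂
    have e0 : ∀ i, H (i + 1) 0 = H₁ i 0 := fun i => by
      simp [hH, hH₁, sum_wordsOfLength_succ]
    have e1 : ∀ j, H 0 (j + 1) = H₂ 0 j := fun j => by
      simp [hH, hH₂, sum_wordsOfLength_succ]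
    have e2 : ∀ i j, H (i + 1) (j + 1) = H₁ i (j + 1) + H₂ (i + 1) j := fun i j => by
      simp only [hH, hH₁, hH₂]
      have : ∀ n, ∑ u ∈ wordsOfLength A (i + 1), ∑ v ∈ wordsOfLength A j,
          shuffleSum (fun w => c (n :: w)) u v • ⁅adWord k B u X, adWord k B (n :: v) Y⁆ =
          ∑ a ∈ A, ∑ u ∈ wordsOfLength A i, ∑ v ∈ wordsOfLength A j,
            shuffleSum (fun w => c (n :: w)) (a :: u) v •
              ⁅adWord k B (a :: u) X, adWord k B (n :: v) Y⁆ := fun n => by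
        rw [sum_wordsOfLength_succ]
      simp only [this]
      rw [sum_wordsOfLength_succ, Finset.sum_comm (s := A) (t := A), ← Finset.sum_add_distrib]
      refine Finset.sum_congr rfl fun a _ => ?_
      rw [Finset.sum_comm (s := A), ← Finset.sum_add_distrib]
      refine Finset.sum_congr rfl fun u _ => ?_
      rw [sum_wordsOfLength_succ, sum_wordsOfLength_succ, ← Finset.sum_add_distrib]
      refine Finset.sum_congr rfl fun b _ => ?_
      rw [← Finset.sum_add_distrib]
      refine Finset.sum_congr rfl fun v _ => ?_
      rw [shuffleSum_cons_cons, add_smul]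
    have lhs : ∑ w ∈ wordsOfLength A (r + 1), c w • adWord k B w ⁅X, Y⁆ =
        ∑ p ∈ Finset.HasAntidiagonal.antidiagonal r, (H₁ p.1 p.2 + H₂ p.1 p.2) := by
      simp only [hH₁, hH₂]
      rw [sum_wordsOfLength_succ, Finset.sum_add_distrib, Finset.sum_comm (t := A),
        Finset.sum_comm (t := A), ← Finset.sum_add_distrib]
      refine Finset.sum_congr rfl fun n _ => ?_
      have h := congrArg (fun Z => ⁅B n, Z⁆) (ih (fun w => c (n :: w)))
      simp only [lie_sum, lie_smul, leibniz_lie (B n), smul_add, Finset.sum_add_distrib] at h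
      simpa only [adWord_cons, Module.End.mul_apply, LieAlgebra.ad_apply] using h
    rw [lhs]
    change _ = ∑ p ∈ Finset.HasAntidiagonal.antidiagonal (r + 1), H p.1 p.2
    cases r with
    | zero => simp [Finset.Nat.antidiagonal_succ, e0, e1, add_comm]
    | succ r =>
      rw [Finset.sum_add_distrib, Finset.Nat.sum_antidiagonal_succ' (n := r),
        Finset.Nat.sum_antidiagonal_succ (n := r) (f := fun p => H₂ p.1 p.2),
        Finset.Nat.sum_antidiagonal_succ (n := r + 1), Finset.Nat.sum_antidiagonal_succ' (n := r)]
      simp only [e0, e1, e2, Finset.sum_add_distrib]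
      abel

end Dynkin

/-! ### Formal sums and operators of positive order. -/

section FormalSums

variable {k M ι : Type*} [Field k] [AddCommGroup M] [Module k M] {F : ℕ → Submodule k M}
  {f : ι → M} {s : M}

theorem HasFormalSum.exists_tail (hs : HasFormalSum F f s) (m : ℕ) :
    ∃ A₀ : Finset ι, ∀ i ∉ A₀, f i ∈ F m := by
  classical
  obtain ⟨A₀, h⟩ := hs m
  refine ⟨A₀, fun i hi => ?_⟩
  have := sub_mem (h A₀ le_rfl) (h (insert i A₀) (Finset.subset_insert i A₀))
  rwa [Finset.sum_insert hi, sub_sub_sub_cancel_left, add_sub_cancel_right] at this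

theorem sum_sub_sum_mem {m : ℕ} {A₀ A A' : Finset ι} (h : ∀ i ∉ A₀, f i ∈ F m) (hA : A₀ ⊆ A)
    (hA' : A ⊆ A') : ∑ i ∈ A', f i - ∑ i ∈ A, f i ∈ F m := by
  classical
  rw [← Finset.sum_sdiff hA', add_sub_cancel_right]
  exact sum_mem fun i hi => h i fun hi' => (Finset.mem_sdiff.1 hi).2 (hA hi')

/-- Any finite set outside which the terms have order `≥ m` computes the sum modulo `F m`; this
allows explicit truncations. -/
theorem HasFormalSum.sub_sum_mem (hs : HasFormalSum F f s) {m : ℕ} {A₀ A : Finset ι}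
    (h : ∀ i ∉ A₀, f i ∈ F m) (hA : A₀ ⊆ A) : s - ∑ i ∈ A, f i ∈ F m := by
  classical
  obtain ⟨A₁, h₁⟩ := hs m
  have := add_mem (h₁ (A ∪ A₁) Finset.subset_union_right)
    (sum_sub_sum_mem h hA (Finset.subset_union_left (s₂ := A₁)))
  rwa [sub_add_sub_cancel] at this

end FormalSums

section EndFiltration

variable {k M : Type*} [Field k] [AddCommGroup M] [Module k M] {F : ℕ → Submodule k M}

theorem endFiltration_antitone (hF : Antitone F) : Antitone (endFiltration F) :=
  fun _ _ h _ hf p X hX => hF (Nat.add_le_add_left h p) (hf p X hX)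

theorem mul_mem_endFiltration {a b : ℕ} {f g : Module.End k M} (hf : f ∈ endFiltration F a)
    (hg : g ∈ endFiltration F b) : f * g ∈ endFiltration F (a + b) := by
  intro p X hX
  have := hf _ _ (hg p X hX)
  rwa [add_assoc, add_comm b a] at this

end EndFiltration

/-! ### Convergence, inversion and automorphisms in a complete filtered Lie algebra. -/

section CompleteFiltration

variable {k L : Type*} [Field k] [LieRing L] [LieAlgebra k L] {F : ℕ → Submodule k L}

namespace IsCompleteLieFiltration

theorem mem_zero (hF : IsCompleteLieFiltration F) (X : L) : X ∈ F 0 := by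
  rw [hF.zero_eq_top]
  trivial

theorem eq_zero (hF : IsCompleteLieFiltration F) {X : L} (h : ∀ m, X ∈ F m) : X = 0 := by
  rw [← Submodule.mem_bot k, ← hF.separated, Submodule.mem_iInf]
  exact h

theorem ad_mem (hF : IsCompleteLieFiltration F) {m : ℕ} {X : L} (hX : X ∈ F m) : LieAlgebra.ad k L X ∈ endFiltration F m := by
  intro p Y hY
  rw [LieAlgebra.ad_apply, add_comm]
  exact hF.lie_mem m p X Y hX hY

theorem apply_mem (hF : IsCompleteLieFiltration F) {m : ℕ} {f : Module.End k L} (hf : f ∈ endFiltration F m) (X : L) :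
    f X ∈ F m := by
  simpa using hf 0 X (hF.mem_zero X)

theorem exists_hasFormalSum (hF : IsCompleteLieFiltration F) {ι : Type*} {f : ι → L}
    (h : ∀ m, ∃ A₀ : Finset ι, ∀ i ∉ A₀, f i ∈ F m) : ∃ s, HasFormalSum F f s := by
  classical
  choose A hA using h
  set A' : ℕ → Finset ι := fun j => (Finset.range (j + 1)).biUnion A with hA'
  have hsub : ∀ {m j}, m ≤ j → A m ⊆ A' j := fun hmj =>
    Finset.subset_biUnion_of_mem A (Finset.mem_range.2 (by omega))
  have hmono : ∀ {i j}, i ≤ j → A' i ⊆ A' j := fun hij =>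
    Finset.biUnion_subset_biUnion_of_subset_left _ (Finset.range_subset_range.2 (by omega))
  obtain ⟨Y, hY⟩ := hF.complete (fun j => ∑ i ∈ A' j, f i) fun m => ⟨m, fun i j hi hj => by
    have h1 := sum_sub_sum_mem (hA m) (hsub le_rfl) (hmono hi)
    have h2 := sum_sub_sum_mem (hA m) (hsub le_rfl) (hmono hj)
    have := sub_mem h1 h2
    rwa [sub_sub_sub_cancel_right] at this⟩
  refine ⟨Y, fun m => ?_⟩
  obtain ⟨i₀, hi₀⟩ := hY m
  refine ⟨A' (max i₀ m), fun A₁ hA₁ => ?_⟩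
  have h1 := hi₀ (max i₀ m) (le_max_left _ _)
  have h2 := sum_sub_sum_mem (hA m) (hsub (le_max_right _ _)) hA₁
  have := neg_mem (add_mem h1 h2)
  convert this using 1
  abel

theorem exists_hasFormalSum_end (hF : IsCompleteLieFiltration F) {ι : Type*} {f : ι → Module.End k L}
    (h : ∀ m, ∃ A₀ : Finset ι, ∀ i ∉ A₀, f i ∈ endFiltration F m) :
    ∃ Ψ, HasFormalSum (endFiltration F) f Ψ := by
  have hX : ∀ X : L, ∃ s, HasFormalSum F (fun i => f i X) s := fun X =>
    hF.exists_hasFormalSum fun m => (h m).imp fun A₀ hA₀ i hi => hF.apply_mem (hA₀ i hi) X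
  choose ψ hψ using hX
  have key : ∀ m, ∃ A₀ : Finset ι, ∀ X, ψ X - ∑ i ∈ A₀, f i X ∈ F m := fun m =>
    (h m).imp fun A₀ hA₀ X =>
      (hψ X).sub_sum_mem (fun i hi => hF.apply_mem (hA₀ i hi) X) le_rfl
  refine ⟨{ toFun := ψ, map_add' := fun X Y => ?_, map_smul' := fun c X => ?_ }, fun m => ?_⟩
  · rw [← sub_eq_zero]
    refine hF.eq_zero fun m => ?_
    obtain ⟨A₀, hA₀⟩ := key m
    have := sub_mem (hA₀ (X + Y)) (add_mem (hA₀ X) (hA₀ Y))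
    simp only [map_add, Finset.sum_add_distrib] at this
    convert this using 1
    abel
  · rw [← sub_eq_zero]
    refine hF.eq_zero fun m => ?_
    obtain ⟨A₀, hA₀⟩ := key m
    have := sub_mem (hA₀ (c • X)) ((F m).smul_mem c (hA₀ X))
    simp only [map_smul, smul_sub, Finset.smul_sum] at this
    convert this using 1
    simp only [RingHom.id_apply]
    abel
  · obtain ⟨A₀, hA₀⟩ := h m
    refine ⟨A₀, fun A hA p X hX => ?_⟩
    rw [LinearMap.sub_apply, LinearMap.sum_apply]
    obtain ⟨A₁, hA₁⟩ := hψ X (p + m)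
    -- The set `A₁` depends on `X` and `p`, but enlarging `A` by it only adds terms outside `A₀`, so
    -- the estimate stays uniform.
    classical
    have h1 := hA₁ (A ∪ A₁) Finset.subset_union_right
    have h2 := sum_sub_sum_mem hA₀ hA (Finset.subset_union_left (s₂ := A₁)) p X hX
    rw [LinearMap.sub_apply, LinearMap.sum_apply, LinearMap.sum_apply] at h2
    have := add_mem h1 h2
    rwa [sub_add_sub_cancel] at this

theorem apply_mem_of_sub_one_mem (hF : IsCompleteLieFiltration F) {Ψ : Module.End k L}
    (h : Ψ - 1 ∈ endFiltration F 1) {p : ℕ} {X : L} (hX : X ∈ F p) : Ψ X ∈ F p := by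
  have := add_mem (hF.antitone (Nat.le_succ p) (h p X hX)) hX
  simpa using this

/-- An operator which differs from the identity by an operator of order `≥ 1` is bijective. -/
theorem bijective_of_sub_one_mem (hF : IsCompleteLieFiltration F) {Ψ : Module.End k L} (h : Ψ - 1 ∈ endFiltration F 1) :
    Function.Bijective Ψ := by
  have hΨ : ∀ p, ∀ X ∈ F p, Ψ X ∈ F p := fun p X hX => hF.apply_mem_of_sub_one_mem h hX
  constructor
  · rw [← LinearMap.ker_eq_bot, LinearMap.ker_eq_bot']
    intro X hX
    refine hF.eq_zero fun m => ?_
    induction m with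
    | zero => exact hF.mem_zero X
    | succ m ih => simpa [hX] using h m X ih
  · intro Y
    -- Neumann iteration: each step applies `1 - Ψ` to the error `Y - Ψ (x j)`, raising its order by
    -- one.
    let x : ℕ → L := fun j => Nat.rec 0 (fun _ X => X + (Y - Ψ X)) j
    have hx : ∀ j, x (j + 1) = x j + (Y - Ψ (x j)) := fun _ => rfl
    have h1 : ∀ j, Y - Ψ (x j) ∈ F j := by
      intro j
      induction j with
      | zero => exact hF.mem_zero _
      | succ j ih =>
        have := neg_mem (h j _ ih)
        convert this using 1
        rw [hx]
        simp only [map_add, map_sub, LinearMap.sub_apply, Module.End.one_apply]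
        abel
    have h2 : ∀ {m i}, m ≤ i → x i - x m ∈ F m := by
      intro m i hi
      induction i, hi using Nat.le_induction with
      | base => simp
      | succ i hi ih =>
        have := add_mem ih (hF.antitone hi (h1 i))
        rw [hx]
        convert this using 1
        abel
    obtain ⟨X, hX⟩ := hF.complete x fun m => ⟨m, fun i j hi hj => by
      have := sub_mem (h2 hi) (h2 hj)
      rwa [sub_sub_sub_cancel_right] at this⟩
    refine ⟨X, ?_⟩
    rw [← sub_eq_zero]
    refine hF.eq_zero fun m => ?_
    obtain ⟨i₀, hi₀⟩ := hX m
    have h3 := hΨ m _ (hi₀ (max i₀ m) (le_max_left _ _))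
    have h4 := hF.antitone (le_max_right i₀ m) (h1 (max i₀ m))
    have := neg_mem (add_mem h3 h4)
    convert this using 1
    rw [map_sub]
    abel

/-- The terms of order `≥ m` are the difference between a square and a triangular sum. -/
theorem sum_antidiagonal_sub_mem (hF : IsCompleteLieFiltration F) {f : ℕ → ℕ → L} (hf : ∀ i j, f i j ∈ F (i + j)) (m : ℕ) :
    ∑ r ∈ Finset.range m, ∑ p ∈ Finset.HasAntidiagonal.antidiagonal r, f p.1 p.2 -
      ∑ i ∈ Finset.range m, ∑ j ∈ Finset.range m, f i j ∈ F m := by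
  rw [Finset.sum_congr rfl fun r _ => Finset.Nat.sum_antidiagonal_eq_sum_range_succ f r,
    Finset.sum_range_diag_flip, ← Finset.sum_sub_distrib]
  refine sum_mem fun i hi => ?_
  rw [← neg_mem_iff, neg_sub, ← Finset.sum_sdiff (Finset.range_subset_range.2 (Nat.sub_le m i)),
    add_sub_cancel_right]
  refine sum_mem fun j hj => hF.antitone ?_ (hf i j)
  simp at hj
  omega

variable {𝒩 : Type*} {Bn : 𝒩 → L}

theorem adWord_mem_length (hF : IsCompleteLieFiltration F) (hBn : ∀ n, Bn n ∈ F 1) (w : List 𝒩) :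
    adWord k Bn w ∈ endFiltration F w.length := by
  induction w with
  | nil => exact fun p X hX => hX
  | cons n w ih =>
    rw [adWord_cons, List.length_cons, add_comm]
    exact mul_mem_endFiltration (hF.ad_mem (hBn n)) ih

theorem adWord_mem_of_mem (hF : IsCompleteLieFiltration F) (hBn : ∀ n, Bn n ∈ F 1) {m : ℕ} {w : List 𝒩} {n : 𝒩} (hn : n ∈ w)
    (h : Bn n ∈ F m) : adWord k Bn w ∈ endFiltration F m := by
  induction w with
  | nil => simp at hn
  | cons n' w ih =>
    rw [adWord_cons]
    rcases List.mem_cons.1 hn with rfl | hn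
    · exact endFiltration_antitone hF.antitone (Nat.le_add_right m w.length)
        (mul_mem_endFiltration (hF.ad_mem h) (hF.adWord_mem_length hBn w))
    · exact endFiltration_antitone hF.antitone (Nat.le_add_left m 1)
        (mul_mem_endFiltration (hF.ad_mem (hBn n')) (ih hn))

/-- A word outside the finite set is either long, each letter adding at least 1 to the order, or
contains a letter of order `≥ m`. -/
theorem adWord_mem (hF : IsCompleteLieFiltration F) (hBn : ∀ n, Bn n ∈ F 1) {m : ℕ} {A : Finset 𝒩} (hA : ∀ n ∉ A, Bn n ∈ F m)
    {w : List 𝒩} (hw : w ∉ wordsBelow A m) : adWord k Bn w ∈ endFiltration F m := by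
  rw [mem_wordsBelow, not_and_or, not_lt] at hw
  rcases hw with hw | hw
  · exact endFiltration_antitone hF.antitone hw (hF.adWord_mem_length hBn w)
  · push Not at hw
    obtain ⟨n, hn, hnA⟩ := hw
    exact hF.adWord_mem_of_mem hBn hn (hA n hnA)

theorem nestedBracket_mem_length (hF : IsCompleteLieFiltration F) (hBn : ∀ n, Bn n ∈ F 1) (w : List 𝒩) :
    nestedBracket Bn w ∈ F w.length := by
  rcases List.eq_nil_or_concat' w with rfl | ⟨v, n, rfl⟩
  · exact zero_mem _
  · rw [nestedBracket_concat (k := k), List.length_append, List.length_singleton, add_comm]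
    exact hF.adWord_mem_length hBn v 1 _ (hBn n)

theorem nestedBracket_mem (hF : IsCompleteLieFiltration F) (hBn : ∀ n, Bn n ∈ F 1) {m : ℕ} {A : Finset 𝒩}
    (hA : ∀ n ∉ A, Bn n ∈ F m) {w : List 𝒩} (hw : w ∉ wordsBelow A m) :
    nestedBracket Bn w ∈ F m := by
  rw [mem_wordsBelow, not_and_or, not_lt] at hw
  rcases hw with hw | hw
  · exact hF.antitone hw (hF.nestedBracket_mem_length hBn w)
  · push Not at hw
    obtain ⟨n, hn, hnA⟩ := hw
    rcases List.eq_nil_or_concat' w with rfl | ⟨v, n', rfl⟩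
    · simp at hn
    rw [nestedBracket_concat (k := k)]
    rcases List.mem_append.1 hn with hn | hn
    · exact hF.apply_mem (hF.adWord_mem_of_mem hBn hn (hA n hnA)) _
    · rw [List.mem_singleton] at hn
      subst hn
      exact hF.antitone (Nat.le_add_right m v.length)
        (hF.adWord_mem_length hBn v m _ (hA n hnA))

/-- Symmetral moulds yield operators compatible with the Lie bracket. -/
theorem map_lie_of_isSymmetral (hF : IsCompleteLieFiltration F) (hBn : ∀ n, Bn n ∈ F 1)
    (hA : ∀ m, ∃ A : Finset 𝒩, ∀ n ∉ A, Bn n ∈ F m) {S : List 𝒩 → k} (hS : IsSymmetral S)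
    {Ψ : Module.End k L}
    (hΨ : HasFormalSum (endFiltration F) (fun w => S w • adWord k Bn w) Ψ) (X Y : L) :
    Ψ ⁅X, Y⁆ = ⁅Ψ X, Ψ Y⁆ := by
  rw [← sub_eq_zero]
  refine hF.eq_zero fun m => ?_
  obtain ⟨A, hA⟩ := hA m
  set P := ∑ w ∈ wordsBelow A m, S w • adWord k Bn w with hP
  have hΨP : Ψ - P ∈ endFiltration F m := hΨ.sub_sum_mem
    (fun w hw => Submodule.smul_mem _ _ (hF.adWord_mem hBn hA hw)) le_rfl
  have hd : ∀ Z, Ψ Z - P Z ∈ F m := fun Z => hF.apply_mem hΨP Z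
  have hPr : ∀ Z, P Z = ∑ r ∈ Finset.range m, ∑ w ∈ wordsOfLength A r, S w • adWord k Bn w Z := by
    intro Z
    rw [hP, sum_wordsBelow]
    simp [LinearMap.sum_apply]
  -- By Leibniz and symmetrality, the first term is a triangular double sum and the second the
  -- square one with the same entries.
  have hmain : P ⁅X, Y⁆ - ⁅P X, P Y⁆ ∈ F m := by
    have h := hF.sum_antidiagonal_sub_mem (f := fun i j =>
      ⁅∑ u ∈ wordsOfLength A i, S u • adWord k Bn u X,
        ∑ v ∈ wordsOfLength A j, S v • adWord k Bn v Y⁆) ?_ m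
    · convert h using 2
      · rw [hPr]
        refine Finset.sum_congr rfl fun r _ => ?_
        rw [sum_smul_adWord_lie]
        refine Finset.sum_congr rfl fun p _ => ?_
        rw [sum_lie]
        refine Finset.sum_congr rfl fun u _ => ?_
        rw [lie_sum]
        refine Finset.sum_congr rfl fun v _ => ?_
        rw [smul_lie, lie_smul, hS.shuffle, mul_smul]
      · rw [hPr, hPr, sum_lie]
        exact Finset.sum_congr rfl fun i _ => lie_sum _ _ _
    · intro i j
      have : ∀ i (Z : L), ∑ u ∈ wordsOfLength A i, S u • adWord k Bn u Z ∈ F i := by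
        intro i Z
        refine sum_mem fun u hu => Submodule.smul_mem _ _ ?_
        have := hF.apply_mem (hF.adWord_mem_length hBn u) Z
        rwa [(mem_wordsOfLength.1 hu).1] at this
      exact hF.lie_mem i j _ _ (this i X) (this j Y)
  have h1 : ⁅Ψ X - P X, Ψ Y⁆ ∈ F m := by
    simpa using hF.lie_mem m 0 _ _ (hd X) (hF.mem_zero _)
  have h2 : ⁅P X, Ψ Y - P Y⁆ ∈ F m := by
    simpa using hF.lie_mem 0 m _ _ (hF.mem_zero _) (hd Y)
  have := sub_mem (sub_mem (add_mem (hd ⁅X, Y⁆) hmain) h1) h2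
  convert this using 1
  simp only [lie_sub, sub_lie]
  abel

end IsCompleteLieFiltration

end CompleteFiltration

/-! ### The conjugacy equation. -/

section Normalization

variable {k L 𝒩 : Type*} [Field k] [LieRing L] [LieAlgebra k L]
  {φ : 𝒩 → k} {X₀ : L} {Bn : 𝒩 → L}

theorem lie_nestedBracket (heig : ∀ n, ⁅X₀, Bn n⁆ = φ n • Bn n) (w : List 𝒩) :
    ⁅X₀, nestedBracket Bn w⁆ = (w.map φ).sum • nestedBracket Bn w := by
  induction w with
  | nil => simp [nestedBracket]
  | cons n w ih =>
    rcases eq_or_ne w [] with rfl | hw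
    · simp [nestedBracket, heig]
    · rw [nestedBracket_cons Bn n hw, leibniz_lie, heig, ih, List.map_cons, List.sum_cons,
        add_smul, smul_lie, lie_smul]

theorem adWord_concat_apply (heig : ∀ n, ⁅X₀, Bn n⁆ = φ n • Bn n) (w : List 𝒩) (n : 𝒩) :
    adWord k Bn (w ++ [n]) X₀ = -φ n • nestedBracket Bn (w ++ [n]) := by
  rw [adWord_concat, nestedBracket_concat (k := k), Module.End.mul_apply, LieAlgebra.ad_apply,
    ← lie_skew, heig, map_neg, map_smul, neg_smul]

/-- The homogeneous component of degree `r + 1` of `Ψ (X₀ + B) - X₀ = N`. -/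
theorem sum_mouldS_smul_adWord [CharZero k] (heig : ∀ n, ⁅X₀, Bn n⁆ = φ n • Bn n)
    (A : Finset 𝒩) (r : ℕ) :
    ∑ w ∈ wordsOfLength A (r + 1), mouldS φ w • adWord k Bn w X₀ +
        ∑ w ∈ wordsOfLength A r, mouldS φ w • adWord k Bn w (∑ n ∈ A, Bn n) =
      ∑ w ∈ wordsOfLength A (r + 1),
        ((1 / (w.length : k)) * mouldR φ w) • nestedBracket Bn w := by
  -- Both M and R/(r + 1) have `dynkinDual` equal to R on words of length `r + 1`, so their
  -- difference is killed by nested brackets.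
  have h := sum_smul_nestedBracket_eq_zero A Bn (r + 1)
    (c := fun w => mouldConj φ w + (-(1 / ((r + 1 : ℕ) : k))) * mouldR φ w) ?_
  · have h1 : ∑ w ∈ wordsOfLength A (r + 1), mouldConj φ w • nestedBracket Bn w =
        ∑ w ∈ wordsOfLength A (r + 1), mouldS φ w • adWord k Bn w X₀ +
          ∑ w ∈ wordsOfLength A r, mouldS φ w • adWord k Bn w (∑ n ∈ A, Bn n) := by
      rw [sum_wordsOfLength_succ', sum_wordsOfLength_succ', ← Finset.sum_add_distrib]
      refine Finset.sum_congr rfl fun w _ => ?_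
      rw [map_sum, Finset.smul_sum, ← Finset.sum_add_distrib]
      refine Finset.sum_congr rfl fun n _ => ?_
      rw [mouldConj_concat, adWord_concat_apply heig, ← nestedBracket_concat, smul_smul,
        ← add_smul]
      congr 1
      ring
    simp only [add_smul, Finset.sum_add_distrib] at h
    rw [← h1, eq_neg_of_add_eq_zero_left h, ← Finset.sum_neg_distrib]
    refine Finset.sum_congr rfl fun w hw => ?_
    rw [(mem_wordsOfLength.1 hw).1, neg_mul, neg_smul, neg_neg]
  · intro w hw hne
    rw [dynkinDual_add, dynkinDual_const_mul, dynkinDual_mouldConj φ hne,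
      (isAlternal_mouldR φ).dynkinDual_eq, List.nil_append, hw]
    have : ((r + 1 : ℕ) : k) ≠ 0 := Nat.cast_ne_zero.2 r.succ_ne_zero
    field_simp
    ring

end Normalization

theorem theorem2p4 {k L 𝒩 : Type*} [Field k] [CharZero k] [LieRing L] [LieAlgebra k L]
    (F : ℕ → Submodule k L) (hF : IsCompleteLieFiltration F)
    (φ : 𝒩 → k) (X₀ B : L) (Bn : 𝒩 → L)
    (hBn : ∀ n, Bn n ∈ F 1)
    (hB : HasFormalSum F Bn B)
    (heig : ∀ n, ⁅X₀, Bn n⁆ = φ n • Bn n) :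
    ∃ (N : L) (Ψ : L ≃ₗ⁅k⁆ L),
      HasFormalSum F
        (fun w : {w : List 𝒩 // w ≠ []} =>
          ((1 / (w.1.length : k)) * mouldR φ w.1) • nestedBracket Bn w.1) N ∧
      HasFormalSum (endFiltration F)
        (fun w : List 𝒩 => mouldS φ w • adWord k Bn w) (Ψ : L →ₗ[k] L) ∧
      Ψ (X₀ + B) = X₀ + N ∧
      ⁅X₀, N⁆ = 0 := by
  classical
  have hA : ∀ m, ∃ A : Finset 𝒩, ∀ n ∉ A, Bn n ∈ F m := hB.exists_tail
  have hSmem : ∀ m (A : Finset 𝒩), (∀ n ∉ A, Bn n ∈ F m) → ∀ w ∉ wordsBelow A m,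
      mouldS φ w • adWord k Bn w ∈ endFiltration F m := fun m A hA w hw =>
    Submodule.smul_mem _ _ (hF.adWord_mem hBn hA hw)
  have hRmem : ∀ m (A : Finset 𝒩), (∀ n ∉ A, Bn n ∈ F m) →
      ∀ w : {w : List 𝒩 // w ≠ []}, w ∉ (wordsBelow A m).subtype (· ≠ []) →
      ((1 / (w.1.length : k)) * mouldR φ w.1) • nestedBracket Bn w.1 ∈ F m := fun m A hA w hw =>
    Submodule.smul_mem _ _ (hF.nestedBracket_mem hBn hA (by simpa using hw))
  obtain ⟨N, hN⟩ := hF.exists_hasFormalSum (f := fun w : {w : List 𝒩 // w ≠ []} =>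
    ((1 / (w.1.length : k)) * mouldR φ w.1) • nestedBracket Bn w.1) fun m =>
      (hA m).elim fun A hA => ⟨_, hRmem m A hA⟩
  obtain ⟨Ψ, hΨ⟩ := hF.exists_hasFormalSum_end (f := fun w => mouldS φ w • adWord k Bn w)
    fun m => (hA m).elim fun A hA => ⟨_, hSmem m A hA⟩
  have hlie := hF.map_lie_of_isSymmetral hBn hA (isSymmetral_mouldS φ) hΨ
  -- Only the empty word has length below 1, and it contributes the identity.
  have hΨ1 : Ψ - 1 ∈ endFiltration F 1 := by
    obtain ⟨A, hA⟩ := hA 1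
    have := hΨ.sub_sum_mem (hSmem 1 A hA) le_rfl
    rw [sum_wordsBelow] at this
    simpa [(isSymmetral_mouldS φ).map_nil] using this
  have hbij : Function.Bijective Ψ := hF.bijective_of_sub_one_mem hΨ1
  have hconj : Ψ (X₀ + B) = X₀ + N := by
    rw [← sub_eq_zero]
    refine hF.eq_zero fun m => ?_
    -- Words of length `≤ m` applied to the Bₙ give brackets of length up to `m + 1`. Truncating at
    -- `m + 1` leaves one unmatched top layer, which `e4` places in `F m`.
    obtain ⟨A₀, hA₀⟩ := hA (m + 1)
    obtain ⟨A₁, hA₁⟩ := hB (m + 1)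
    set A := A₀ ∪ A₁
    have hA : ∀ n ∉ A, Bn n ∈ F (m + 1) := fun n hn =>
      hA₀ n fun h => hn (Finset.mem_union_left _ h)
    have hBA := hA₁ A Finset.subset_union_right
    have e1 := hF.apply_mem (hΨ.sub_sum_mem (hSmem _ A hA) le_rfl) (X₀ + ∑ n ∈ A, Bn n)
    have e2 := hN.sub_sum_mem (hRmem _ A hA) le_rfl
    have e3 : Ψ (B - ∑ n ∈ A, Bn n) ∈ F (m + 1) :=
      hF.apply_mem_of_sub_one_mem hΨ1 hBA
    have e4 : ∑ w ∈ wordsOfLength A m, mouldS φ w • adWord k Bn w (∑ n ∈ A, Bn n) ∈ F m := by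
      refine sum_mem fun w hw => Submodule.smul_mem _ _ ?_
      have := hF.apply_mem (hF.adWord_mem_length hBn w) (∑ n ∈ A, Bn n)
      rwa [(mem_wordsOfLength.1 hw).1] at this
    have e5 : ∑ w ∈ (wordsBelow A (m + 1)).subtype (· ≠ []),
        ((1 / (w.1.length : k)) * mouldR φ w.1) • nestedBracket Bn w.1 =
        ∑ r ∈ Finset.range m, ∑ w ∈ wordsOfLength A (r + 1),
          ((1 / (w.length : k)) * mouldR φ w) • nestedBracket Bn w := by
      rw [Finset.sum_subtype_eq_sum_filter (s := wordsBelow A (m + 1)) (p := (· ≠ []))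
        (f := fun w => ((1 / (w.length : k)) * mouldR φ w) • nestedBracket Bn w),
        Finset.sum_filter_of_ne, sum_wordsBelow, Finset.sum_range_succ']
      · simp [nestedBracket]
      · rintro w - hw rfl
        simp [nestedBracket] at hw
    have e6 : (∑ w ∈ wordsBelow A (m + 1), mouldS φ w • adWord k Bn w) (X₀ + ∑ n ∈ A, Bn n) =
        X₀ + ∑ r ∈ Finset.range m, ∑ w ∈ wordsOfLength A (r + 1),
          ((1 / (w.length : k)) * mouldR φ w) • nestedBracket Bn w +
          ∑ w ∈ wordsOfLength A m, mouldS φ w • adWord k Bn w (∑ n ∈ A, Bn n) := by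
      rw [Finset.sum_congr rfl fun r _ => (sum_mouldS_smul_adWord heig A r).symm,
        Finset.sum_add_distrib, map_add, sum_wordsBelow]
      simp only [LinearMap.sum_apply, LinearMap.smul_apply]
      rw [Finset.sum_range_succ', sum_wordsOfLength_zero, (isSymmetral_mouldS φ).map_nil,
        Finset.sum_range_succ]
      simp only [adWord_nil, Module.End.one_apply, one_smul]
      abel
    rw [e5] at e2
    rw [LinearMap.sub_apply, e6] at e1
    have := add_mem (hF.antitone m.le_succ (sub_mem (add_mem e1 e3) e2)) e4
    convert this using 1
    simp only [map_add, map_sub]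
    abel
  refine ⟨N, LieEquiv.ofBijective { Ψ with map_lie' := fun {X Y} => hlie X Y } hbij, hN, ?_,
    hconj, ?_⟩
  · exact hΨ
  · refine hF.eq_zero fun m => ?_
    obtain ⟨A, hA⟩ := hA m
    have h := hN.sub_sum_mem (hRmem m A hA) le_rfl
    have h0 := hF.lie_mem 0 m X₀ _ (hF.mem_zero _) h
    rw [lie_sub, lie_sum, Finset.sum_eq_zero, sub_zero, zero_add] at h0
    · exact h0
    · intro w _
      rw [lie_smul, lie_nestedBracket heig, smul_smul, mul_assoc, mul_comm (mouldR φ w.1),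
        sum_mul_mouldR, mul_zero, zero_smul]
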